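/- **Setting.** Let $(\mathbf C,\otimes,I,\tau)$ be a symmetric monoidal category (for instance a cocomplete closed one) and $\mathbf{Alg}$ the category of associative and unital algebras in $\mathbf C$. Let $\mathbf{Loc}$ be the category whose objects are the oriented and time-oriented globally hyperbolic Lorentzian manifolds and whose morphisms are the orientation and time-orientation preserving isometric embeddings $f:M\to N$ with causally convex and open image. Two morphisms $f_1:M_1\to N$, $f_2:M_2\to N$ are causally disjoint if $\big(J_N^+(f_1(M_1))\cup J_N^-(f_1(M_1))\big)\cap f_2(M_2)=\emptyset$. The category $\mathbf{AQFT}$ has as objects the functors $\mathfrak A:\mathbf{Loc}\to\mathbf{Alg}$ satisfying Einstein causality, i.e. $\mu_N\circ(\mathfrak A(f_1)\otimes\mathfrak A(f_2))=\mu_N^{\mathrm{op}}\circ(\mathfrak A(f_1)\otimes\mathfrak A(f_2))$ for all causally disjoint $f_1,f_2$ with target $N$ (where $\mu_N$ is the multiplication of $\mathfrak A(N)$), and as morphisms the natural transformations. A finite (possibly empty) tuple $\underline f=(f_1:M_1\to N,\dots,f_n:M_n\to N)$ of $\mathbf{Loc}$-morphisms with pairwise disjoint images is *time-ordered* if $J^+_N(f_i(M_i))\cap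 f_j(M_j)=\emptyset$ for all $i<j$, and *time-orderable* if $\underline f\rho=(f_{\rho(1)},\dots,f_{\rho(n)})$ is time-ordered for some permutation $\rho\in\Sigma_n$, called a *time-ordering permutation* for $\underline f$. A *time-orderable prefactorization algebra* $\mathfrak F$ consists of an object $\mathfrak F(M)\in\mathbf C$ for each $M\in\mathbf{Loc}$ and a morphism $\mathfrak F(\underline f):\bigotimes_{i=1}^n\mathfrak F(M_i)\to\mathfrak F(N)$ (the *time-ordered product*; a morphism $I\to\mathfrak F(N)$ if $n=0$) for each time-orderable tuple $\underline f$, such that 1. $\mathfrak F(\underline f)\circ\bigotimes_i\mathfrak F(\underline g_i)=\mathfrak F\big(\underline f(\underline g_1,\dots,\underline g_n)\big)$ for all time-orderable $\underline f=(f_1,\dots,f_n):\underline M\to N$ and $\underline g_i=(g_{i1},\dots,g_{ik_i}):\underline L_i\to M_i$, where $\underline f(\underline g_1,\dots,\underline g_n)=(f_1g_{11},\dots,f_ng_{nk_n})$ (which is again time-orderable); 2. $\mathfrak F(\mathrm{id}_M)=\mathrm{id}_{\mathfrak F(M)}$ for all $M$; 3. $\mathfrak F(\underline f)$ equals the permutation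 isomorphism $\bigotimes_i\mathfrak F(M_i)\to\bigotimes_i\mathfrak F(M_{\sigma(i)})$ followed by $\mathfrak F(\underline f\sigma)$, for all time-orderable $\underline f$ and all $\sigma\in\Sigma_n$. A morphism $\zeta:\mathfrak F\to\mathfrak G$ is a family $\zeta_M:\mathfrak F(M)\to\mathfrak G(M)$ of $\mathbf C$-morphisms with $\zeta_N\circ\mathfrak F(\underline f)=\mathfrak G(\underline f)\circ\bigotimes_i\zeta_{M_i}$ for all time-orderable $\underline f:\underline M\to N$. This defines the category $\mathbf{tPFA}$. **Theorem 4.4.** For every $\mathfrak A\in\mathbf{AQFT}$, the following data define a time-orderable prefactorization algebra $\mathbb F[\mathfrak A]\in\mathbf{tPFA}$: (i) $\mathbb F[\mathfrak A](M):=\mathfrak A(M)\in\mathbf C$, the object underlying the algebra $\mathfrak A(M)$, for each $M\in\mathbf{Loc}$; (ii) for each time-orderable tuple $\underline f=(f_1,\dots,f_n):\underline M\to N$, the time-ordered product $$\mathbb F[\mathfrak A](\underline f):\ \bigotimes_{i=1}^n\mathfrak A(M_i)\xrightarrow{\ \text{permute}\ }\bigotimes_{i=1}^n\mathfrak A(M_{\rho(i)})\xrightarrow{\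 \bigotimes_i\mathfrak A(f_{\rho(i)})\ }\mathfrak A(N)^{\otimes n}\xrightarrow{\ \mu_N^{(n)}\ }\mathfrak A(N),$$ where $\rho$ is a time-ordering permutation for $\underline f$ and $\mu_N^{(n)}$ is the $n$-ary multiplication in the given order; this morphism does not depend on the choice of $\rho$, and for the empty tuple it is the unit $\eta_N:I\to\mathfrak A(N)$. Moreover, for every morphism $\kappa:\mathfrak A\to\mathfrak B$ in $\mathbf{AQFT}$ the family of underlying $\mathbf C$-morphisms $\kappa_M:\mathfrak A(M)\to\mathfrak B(M)$ is a morphism $\mathbb F[\kappa]:\mathbb F[\mathfrak A]\to\mathbb F[\mathfrak B]$ in $\mathbf{tPFA}$, and $\mathfrak A\mapsto\mathbb F[\mathfrak A]$, $\kappa\mapsto\mathbb F[\kappa]$ is a functor $\mathbb F:\mathbf{AQFT}\to\mathbf{tPFA}$. -/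

import Mathlib

open CategoryTheory MonoidalCategory Topology
open scoped MonObj

universe u v w

noncomputable section

namespace LorentzQFT

section Geometry

open scoped Manifold ContDiff

/-! ## Oriented and time-oriented Lorentzian manifolds -/

/-- An oriented and time-oriented Lorentzian manifold: a smooth, Hausdorff, second countable
manifold of dimension `dim` (without boundary) with a smooth metric of signature `(- + ... +)`,
a smooth everywhere time-like vector field, and an orientation. -/
structure LorentzManifold where
  carrier : Type u
  dim : ℕ
  [top : TopologicalSpace carrier]
  [charted : ChartedSpace (EuclideanSpace ℝ (Fin dim)) carrier]
  [smooth : IsManifold 𝓘(ℝ, EuclideanSpace ℝ (Fin dim)) ∞ carrier]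
  [hausdorff : T2Space carrier]
  [secondCountable : SecondCountableTopology carrier]
  /-- the metric `g` -/
  metric : ∀ x : carrier,
    TangentSpace 𝓘(ℝ, EuclideanSpace ℝ (Fin dim)) x →L[ℝ]
      TangentSpace 𝓘(ℝ, EuclideanSpace ℝ (Fin dim)) x →L[ℝ] ℝ
  metric_smooth : ContMDiff 𝓘(ℝ, EuclideanSpace ℝ (Fin dim))
    (𝓘(ℝ, EuclideanSpace ℝ (Fin dim)).prod
      𝓘(ℝ, EuclideanSpace ℝ (Fin dim) →L[ℝ] EuclideanSpace ℝ (Fin dim) →L[ℝ] ℝ)) ∞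
    (fun x => Bundle.TotalSpace.mk'
      (EuclideanSpace ℝ (Fin dim) →L[ℝ] EuclideanSpace ℝ (Fin dim) →L[ℝ] ℝ)
      (E := fun x : carrier => TangentSpace 𝓘(ℝ, EuclideanSpace ℝ (Fin dim)) x →L[ℝ]
        TangentSpace 𝓘(ℝ, EuclideanSpace ℝ (Fin dim)) x →L[ℝ] ℝ) x (metric x))
  metric_symm : ∀ x v w, metric x v w = metric x w v
  /-- the signature is `(- + ... +)`: there is an orthonormal basis with one negative vector -/
  metric_signature : ∀ x, ∃ (b : Module.Basis (Fin dim) ℝ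
      (TangentSpace 𝓘(ℝ, EuclideanSpace ℝ (Fin dim)) x)) (i₀ : Fin dim),
    ∀ i j, metric x (b i) (b j) = if i = j then (if i = i₀ then -1 else 1) else 0
  /-- the vector field `𝔱` that determines the time-orientation -/
  timeField : ∀ x : carrier, TangentSpace 𝓘(ℝ, EuclideanSpace ℝ (Fin dim)) x
  timeField_smooth : ContMDiff 𝓘(ℝ, EuclideanSpace ℝ (Fin dim))
    𝓘(ℝ, EuclideanSpace ℝ (Fin dim)).tangent ∞
    (fun x => (⟨x, timeField x⟩ : TangentBundle 𝓘(ℝ, EuclideanSpace ℝ (Fin dim)) carrier))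
  timeField_timelike : ∀ x, metric x (timeField x) (timeField x) < 0
  /-- an orientation of every tangent space ... -/
  orientation : ∀ x : carrier,
    Orientation ℝ (TangentSpace 𝓘(ℝ, EuclideanSpace ℝ (Fin dim)) x) (Fin dim)
  /-- ... which, around every point, is the standard orientation in a suitable smooth chart -/
  orientation_chart : ∀ x₀ : carrier,
    ∃ φ ∈ IsManifold.maximalAtlas 𝓘(ℝ, EuclideanSpace ℝ (Fin dim)) ∞ carrier, x₀ ∈ φ.source ∧
      ∀ x ∈ φ.source, ∀ b : Module.Basis (Fin dim) ℝ
          (TangentSpace 𝓘(ℝ, EuclideanSpace ℝ (Fin dim)) x),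
        b.orientation = orientation x ↔
          0 < Matrix.det (Matrix.of fun i j : Fin dim =>
            NormedSpace.fromTangentSpace (φ x)
              (mfderiv 𝓘(ℝ, EuclideanSpace ℝ (Fin dim)) 𝓘(ℝ, EuclideanSpace ℝ (Fin dim))
                φ x (b j)) i)

attribute [instance] LorentzManifold.top LorentzManifold.charted LorentzManifold.smooth
  LorentzManifold.hausdorff LorentzManifold.secondCountable

namespace LorentzManifold

instance : CoeSort LorentzManifold.{u} (Type u) := ⟨carrier⟩

/-- The model space of a Lorentzian manifold. -/
abbrev Model (M : LorentzManifold.{u}) : Type := EuclideanSpace ℝ (Fin M.dim)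

/-- The tangent space `T_x M`. -/
abbrev Tangent (M : LorentzManifold.{u}) (x : M) : Type := TangentSpace 𝓘(ℝ, M.Model) x

variable {M : LorentzManifold.{u}}

/-- A non-zero tangent vector with `g(v,v) < 0`. -/
def IsTimelike {x : M} (v : M.Tangent x) : Prop := v ≠ 0 ∧ M.metric x v v < 0

/-- A non-zero tangent vector with `g(v,v) ≤ 0`. -/
def IsCausal {x : M} (v : M.Tangent x) : Prop := v ≠ 0 ∧ M.metric x v v ≤ 0

/-- A causal tangent vector with `g(𝔱,v) < 0`. -/
def IsFutureCausal {x : M} (v : M.Tangent x) : Prop :=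
  IsCausal v ∧ M.metric x (M.timeField x) v < 0

/-- The velocity of a curve. -/
def velocity (c : ℝ → M) (t : ℝ) : M.Tangent (c t) :=
  mfderiv 𝓘(ℝ, ℝ) 𝓘(ℝ, M.Model) c t (1 : ℝ)

/-- Open intervals (possibly unbounded, non-empty). -/
def IsOpenInterval (I : Set ℝ) : Prop := IsOpen I ∧ I.OrdConnected ∧ I.Nonempty

/-- `c` restricted to the open interval `I` is a future directed causal curve. -/
def IsFutureCausalCurve (c : ℝ → M) (I : Set ℝ) : Prop :=
  IsOpenInterval I ∧ ContMDiffOn 𝓘(ℝ, ℝ) 𝓘(ℝ, M.Model) ∞ c I ∧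
    ∀ t ∈ I, IsFutureCausal (velocity c t)

/-- `c` restricted to the open interval `I` is a time-like curve. -/
def IsTimelikeCurve (c : ℝ → M) (I : Set ℝ) : Prop :=
  IsOpenInterval I ∧ ContMDiffOn 𝓘(ℝ, ℝ) 𝓘(ℝ, M.Model) ∞ c I ∧
    ∀ t ∈ I, IsTimelike (velocity c t)

/-- `y` is `x`, or is reached from `x` along a future directed causal curve. -/
def CausallyPrecedes (x y : M) : Prop :=
  x = y ∨ ∃ (c : ℝ → M) (I : Set ℝ) (s t : ℝ), IsFutureCausalCurve c I ∧
    s ∈ I ∧ t ∈ I ∧ s < t ∧ c s = x ∧ c t = y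

/-- The causal future `J⁺(S)`. -/
def causalFuture (S : Set M) : Set M := {y | ∃ x ∈ S, CausallyPrecedes x y}

/-- The causal past `J⁻(S)`; a past directed causal curve from `x` to `y` is, run backwards,
a future directed causal curve from `y` to `x`. -/
def causalPast (S : Set M) : Set M := {y | ∃ x ∈ S, CausallyPrecedes y x}

/-- `J⁺(S) ∩ J⁻(S) ⊆ S`. -/
def CausallyConvex (S : Set M) : Prop := causalFuture S ∩ causalPast S ⊆ S

/-- `(J⁺(S) ∪ J⁻(S)) ∩ S' = ∅`. -/
def CausallyDisjoint (S S' : Set M) : Prop := (causalFuture S ∪ causalPast S) ∩ S' = ∅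

/-- The curve `c : I → M` has no endpoint in `M`, neither in the direction of the supremum
nor of the infimum of `I`. -/
def IsInextensible (c : ℝ → M) (I : Set ℝ) : Prop :=
  (¬ ∃ p : M, Filter.Tendsto (fun t : I => c t) Filter.atTop (𝓝 p)) ∧
  (¬ ∃ p : M, Filter.Tendsto (fun t : I => c t) Filter.atBot (𝓝 p))

/-- A subset met exactly once by each inextensible time-like curve. -/
def IsCauchySurface (S : Set M) : Prop :=
  ∀ (c : ℝ → M) (I : Set ℝ), IsTimelikeCurve c I → IsInextensible c I → ∃! t, t ∈ I ∧ c t ∈ S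

end LorentzManifold

open LorentzManifold

/-! ## The category `Loc` -/

/-- Oriented and time-oriented globally hyperbolic Lorentzian manifolds. -/
structure Loc extends LorentzManifold.{u} where
  globallyHyperbolic : ∃ S : Set toLorentzManifold, IsCauchySurface S

namespace Loc

instance : CoeSort Loc.{u} (Type u) := ⟨fun M => M.carrier⟩

/-- Orientation and time-orientation preserving isometric embeddings (diffeomorphisms onto
an open subset) with causally convex image. -/
@[ext]
structure Hom (M N : Loc.{u}) where
  toFun : M.toLorentzManifold → N.toLorentzManifold
  isOpenEmbedding : IsOpenEmbedding toFun
  isLocalDiffeomorph : IsLocalDiffeomorph 𝓘(ℝ, M.Model) 𝓘(ℝ, N.Model) ∞ toFun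
  isometric : ∀ x (v w : M.Tangent x),
    N.metric (toFun x) (mfderiv 𝓘(ℝ, M.Model) 𝓘(ℝ, N.Model) toFun x v)
      (mfderiv 𝓘(ℝ, M.Model) 𝓘(ℝ, N.Model) toFun x w) = M.metric x v w
  /-- the differentials match the future directed causal vectors -/
  timeOrientation : ∀ x (v : M.Tangent x), IsCausal v →
    (M.metric x (M.timeField x) v < 0 ↔
      N.metric (toFun x) (N.timeField (toFun x))
        (mfderiv 𝓘(ℝ, M.Model) 𝓘(ℝ, N.Model) toFun x v) < 0)
  /-- the differentials send positively oriented bases to positively oriented bases -/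
  orientation : ∀ x (b : Module.Basis (Fin M.dim) ℝ (M.Tangent x)),
    b.orientation = M.orientation x →
    ∃ (h : N.dim = M.dim) (b' : Module.Basis (Fin N.dim) ℝ (N.Tangent (toFun x))),
      (∀ i, b' i = mfderiv 𝓘(ℝ, M.Model) 𝓘(ℝ, N.Model) toFun x (b (Fin.cast h i))) ∧
      b'.orientation = N.orientation (toFun x)
  causallyConvex : CausallyConvex (Set.range toFun)

namespace Hom

variable {L M N : Loc.{u}}

lemma mdifferentiableAt (f : Hom M N) (x : M) :
    MDifferentiableAt 𝓘(ℝ, M.Model) 𝓘(ℝ, N.Model) f.toFun x :=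
  f.isLocalDiffeomorph.mdifferentiable (by simp) x

lemma isCausal_map_iff (f : Hom M N) (x : M) (v : M.Tangent x) :
    IsCausal (M := N.toLorentzManifold) (x := f.toFun x)
      (mfderiv 𝓘(ℝ, M.Model) 𝓘(ℝ, N.Model) f.toFun x v) ↔ IsCausal v := by
  have h0 : mfderiv 𝓘(ℝ, M.Model) 𝓘(ℝ, N.Model) f.toFun x v = 0 ↔ v = 0 :=
    (f.isLocalDiffeomorph.mfderivToContinuousLinearEquiv (by simp) x).map_eq_zero_iff
  unfold IsCausal
  rw [f.isometric, Ne, h0]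

lemma isFutureCausal_map_iff (f : Hom M N) (x : M) (v : M.Tangent x) :
    IsFutureCausal (M := N.toLorentzManifold) (x := f.toFun x)
      (mfderiv 𝓘(ℝ, M.Model) 𝓘(ℝ, N.Model) f.toFun x v) ↔ IsFutureCausal v := by
  unfold IsFutureCausal
  rw [isCausal_map_iff]
  exact and_congr_right fun hv => (f.timeOrientation x v hv).symm

/-- A causal curve in the target that connects two points of the image comes from the source. -/
lemma causallyPrecedes_of_map (f : Hom M N) {x y : M.toLorentzManifold}
    (h : CausallyPrecedes (f.toFun x) (f.toFun y)) : CausallyPrecedes x y := by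
  rcases h with h | ⟨c, I, s, t, ⟨hI, hc, hv⟩, hs, ht, hst, hcs, hct⟩
  · exact Or.inl (f.isOpenEmbedding.injective h)
  have hn : Nonempty M.toLorentzManifold := ⟨x⟩
  have hinj : Function.Injective f.toFun := f.isOpenEmbedding.injective
  set W : Set ℝ := I ∩ c ⁻¹' Set.range f.toFun with hW
  have hWo : IsOpen W := hc.continuousOn.isOpen_inter_preimage hI.1 f.isOpenEmbedding.isOpen_range
  have hsub : Set.Icc s t ⊆ W := by
    intro r hr
    refine ⟨hI.2.1.out hs ht hr, f.causallyConvex ⟨⟨_, ⟨x, rfl⟩, ?_⟩, ⟨_, ⟨y, rfl⟩, ?_⟩⟩⟩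
    · rcases hr.1.eq_or_lt with h | h
      · exact Or.inl (by rw [← h, hcs])
      · exact Or.inr ⟨c, I, s, r, ⟨hI, hc, hv⟩, hs, hI.2.1.out hs ht hr, h, hcs, rfl⟩
    · rcases hr.2.eq_or_lt with h | h
      · exact Or.inl (by rw [h, hct])
      · exact Or.inr ⟨c, I, r, t, ⟨hI, hc, hv⟩, hI.2.1.out hs ht hr, ht, h, rfl, hct⟩
  have hsW : s ∈ W := hsub ⟨le_rfl, hst.le⟩
  set c' : ℝ → M.toLorentzManifold := fun r => Function.invFun f.toFun (c r) with hc'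
  have hfc : ∀ r ∈ W, f.toFun (c' r) = c r := fun r hr => Function.invFun_eq hr.2
  have hsm : ∀ r ∈ W, ContMDiffAt 𝓘(ℝ, ℝ) 𝓘(ℝ, M.Model) ∞ c' r := by
    intro r hr
    have hcr : ContMDiffAt 𝓘(ℝ, ℝ) 𝓘(ℝ, N.Model) ∞ c r := hc.contMDiffAt (hI.1.mem_nhds hr.1)
    have hl := f.isLocalDiffeomorph (c' r)
    have h1 := hl.localInverse_contMDiffAt
    rw [hfc r hr] at h1
    refine (h1.comp r hcr).congr_of_eventuallyEq ?_
    have hmem : hl.localInverse.source ∈ 𝓝 (c r) := by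
      rw [← hfc r hr]
      exact hl.localInverse_open_source.mem_nhds hl.localInverse_mem_source
    filter_upwards [hcr.continuousAt.preimage_mem_nhds hmem, hWo.mem_nhds hr] with u hu huW
    apply hinj
    rw [hfc u huW]
    exact (hl.localInverse_right_inv hu).symm
  have hvel : ∀ r ∈ W, IsFutureCausal (velocity c' r) := by
    intro r hr
    rw [← isFutureCausal_map_iff f]
    have hd := mfderiv_comp r (f.mdifferentiableAt (c' r))
      ((hsm r hr).mdifferentiableAt (by simp))
    have he : f.toFun ∘ c' =ᶠ[𝓝 r] c := by
      filter_upwards [hWo.mem_nhds hr] with u hu using hfc u hu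
    rw [he.mfderiv_eq] at hd
    have key : ∀ (p q : N.toLorentzManifold) (_ : p = q) (w : N.Model),
        IsFutureCausal (M := N.toLorentzManifold) (x := p) w →
        IsFutureCausal (M := N.toLorentzManifold) (x := q) w := by
      rintro p _ rfl w h; exact h
    refine key (c r) _ (hfc r hr).symm _ ?_
    have h2 := hv r hr.1
    unfold velocity at h2
    rw [hd] at h2
    exact h2
  refine Or.inr ⟨c', connectedComponentIn W s, s, t, ⟨⟨hWo.connectedComponentIn,
    isPreconnected_connectedComponentIn.ordConnected, s, mem_connectedComponentIn hsW⟩, ?_, ?_⟩,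
    mem_connectedComponentIn hsW, ?_, hst, ?_, ?_⟩
  · exact fun r hr => (hsm r (connectedComponentIn_subset _ _ hr)).contMDiffWithinAt
  · exact fun r hr => hvel r (connectedComponentIn_subset _ _ hr)
  · exact isPreconnected_Icc.subset_connectedComponentIn ⟨le_rfl, hst.le⟩ hsub ⟨hst.le, le_rfl⟩
  · exact hinj ((hfc s hsW).trans hcs)
  · exact hinj ((hfc t (hsub ⟨hst.le, le_rfl⟩)).trans hct)

/-- The identity morphism. -/
protected def id (M : Loc.{u}) : Hom M M where
  toFun := id
  isOpenEmbedding := IsOpenEmbedding.id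
  isLocalDiffeomorph := (Diffeomorph.refl 𝓘(ℝ, M.Model) M.carrier ∞).isLocalDiffeomorph
  isometric x v w := by rw [mfderiv_id]; rfl
  timeOrientation x v _ := by rw [mfderiv_id]; rfl
  orientation x b hb := ⟨rfl, b, fun i => by rw [mfderiv_id]; rfl, hb⟩
  causallyConvex := by
    rw [Set.range_id]; exact Set.subset_univ _

/-- The composition `g ∘ f`. -/
protected def comp (f : Hom L M) (g : Hom M N) : Hom L N where
  toFun := g.toFun ∘ f.toFun
  isOpenEmbedding := g.isOpenEmbedding.comp f.isOpenEmbedding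
  isLocalDiffeomorph x := (f.isLocalDiffeomorph x).comp _ _ (g.isLocalDiffeomorph (f.toFun x))
  isometric x v w := by
    rw [mfderiv_comp x (g.mdifferentiableAt _) (f.mdifferentiableAt _)]
    exact (g.isometric _ _ _).trans (f.isometric _ _ _)
  timeOrientation x v hv := by
    rw [mfderiv_comp x (g.mdifferentiableAt _) (f.mdifferentiableAt _)]
    exact (f.timeOrientation x v hv).trans
      (g.timeOrientation _ _ ((f.isCausal_map_iff x v).2 hv))
  orientation x b hb := by
    rw [mfderiv_comp x (g.mdifferentiableAt _) (f.mdifferentiableAt _)]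
    obtain ⟨h, b', h', hb'⟩ := f.orientation x b hb
    obtain ⟨k, b'', h'', hb''⟩ := g.orientation _ b' hb'
    refine ⟨k.trans h, b'', fun i => ?_, hb''⟩
    rw [h'', h']; rfl
  causallyConvex := by
    rintro y ⟨⟨_, ⟨p, rfl⟩, hp⟩, ⟨_, ⟨q, rfl⟩, hq⟩⟩
    obtain ⟨z, rfl⟩ := g.causallyConvex ⟨⟨_, ⟨f.toFun p, rfl⟩, hp⟩, ⟨_, ⟨f.toFun q, rfl⟩, hq⟩⟩
    obtain ⟨z', rfl⟩ := f.causallyConvex ⟨⟨_, ⟨p, rfl⟩, g.causallyPrecedes_of_map hp⟩,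
      ⟨_, ⟨q, rfl⟩, g.causallyPrecedes_of_map hq⟩⟩
    exact ⟨z', rfl⟩

end Hom

instance : Category.{u} Loc.{u} where
  Hom := Hom
  id := Hom.id
  comp := Hom.comp

/-- The image `f(M) ⊆ N`. -/
def image {M N : Loc.{u}} (f : M ⟶ N) : Set N.toLorentzManifold := Set.range (Hom.toFun f)

end Loc

end Geometry

open LorentzManifold

/-! ## Finite ordered tensor products in a symmetric monoidal category -/

section Tensor

variable {C : Type w} [Category.{v} C] [MonoidalCategory C] {α β : Type*}

/-- `X a₁ ⊗ (X a₂ ⊗ (... ⊗ (X aₙ ⊗ I)))` for the list `[a₁, ..., aₙ]`; it is the monoidal unit `I`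
for the empty list. -/
def tensor (X : α → C) : List α → C
  | [] => 𝟙_ C
  | a :: l => X a ⊗ tensor X l

/-- `φ a₁ ⊗ ... ⊗ φ aₙ`. -/
def tensorMap {X Y : α → C} (φ : ∀ a, X a ⟶ Y a) : ∀ l : List α, tensor X l ⟶ tensor Y l
  | [] => 𝟙 (𝟙_ C)
  | a :: l => φ a ⊗ₘ tensorMap φ l

lemma tensorMap_id (X : α → C) (l : List α) :
    tensorMap (fun a => 𝟙 (X a)) l = 𝟙 (tensor X l) := by
  induction l with
  | nil => rfl
  | cons a l ih => simp only [tensorMap, ih]; exact id_tensorHom_id _ _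

lemma tensorMap_comp {X Y Z : α → C} (φ : ∀ a, X a ⟶ Y a) (ψ : ∀ a, Y a ⟶ Z a)
    (l : List α) : tensorMap (fun a => φ a ≫ ψ a) l = tensorMap φ l ≫ tensorMap ψ l := by
  induction l with
  | nil => exact (Category.id_comp _).symm
  | cons a l ih => simp only [tensorMap, ih]; exact (tensorHom_comp_tensorHom _ _ _ _).symm

/-- The identification of `X (u b₁) ⊗ ... ⊗ X (u bₙ)`, as a tensor product over `[b₁, ..., bₙ]`
and as a tensor product over `[u b₁, ..., u bₙ]`. -/
def tensorReindex (X : α → C) (u : β → α) :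
    ∀ l : List β, tensor (fun b => X (u b)) l ⟶ tensor X (l.map u)
  | [] => 𝟙 (𝟙_ C)
  | b :: l => X (u b) ◁ tensorReindex X u l

/-- Rebracketing `(⊗_{a ∈ l} X a) ⊗ (⊗_{a ∈ l'} X a) ⟶ ⊗_{a ∈ l ++ l'} X a`. -/
def tensorAppend (X : α → C) : ∀ l l' : List α, tensor X l ⊗ tensor X l' ⟶ tensor X (l ++ l')
  | [], l' => (λ_ (tensor X l')).hom
  | a :: l, l' => (α_ (X a) (tensor X l) (tensor X l')).hom ≫ X a ◁ tensorAppend X l l'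

/-- Rebracketing `⊗_i ⊗_j X a_{ij} ⟶ X a_{11} ⊗ ... ⊗ X a_{n kₙ}`, where `a_{i1}, a_{i2}, ...` are
the entries of the list `u b_i`. -/
def tensorFlatten (X : α → C) (u : β → List α) :
    ∀ l : List β, tensor (fun b => tensor X (u b)) l ⟶ tensor X (l.flatMap u)
  | [] => 𝟙 (𝟙_ C)
  | b :: l => tensor X (u b) ◁ tensorFlatten X u l ≫ tensorAppend X (u b) (l.flatMap u)

/-- The `n`-ary multiplication `A ⊗ ... ⊗ A ⟶ A`, `a₁ ⊗ ... ⊗ aₙ ↦ a₁ ⋯ aₙ`, of an associative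
and unital algebra, with `n` the length of the list; it is the unit `I ⟶ A` for `n = 0`. -/
def naryMul (A : Mon C) : ∀ l : List α, tensor (fun _ => A.X) l ⟶ A.X
  | [] => η[A.X]
  | _ :: l => A.X ◁ naryMul A l ≫ μ[A.X]

/-- A permutation `σ` of the positions of the list `l = [a_1, ..., a_n]`, with
`l' = [a_{σ(1)}, ..., a_{σ(n)}]`, recorded by choosing the position of the first entry of `l'` in
`l`, then the position of the second one among the remaining entries of `l`, and so on.
Every permutation of the `n` positions is given by exactly one such sequence of choices. -/
inductive Reordering {α : Type*} : List α → List α → Type _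
  | nil : Reordering [] []
  | cons {l l' : List α} (i : Fin l.length) (σ : Reordering (l.eraseIdx i) l') :
      Reordering l (l.get i :: l')

variable [SymmetricCategory C]

/-- The symmetry isomorphism that moves the factor at position `i` to the front. -/
def tensorExtract (X : α → C) :
    ∀ (l : List α) (i : Fin l.length), tensor X l ⟶ X (l.get i) ⊗ tensor X (l.eraseIdx i)
  | [], i => i.elim0
  | a :: l, ⟨0, _⟩ => 𝟙 (X a ⊗ tensor X l)
  | a :: l, ⟨i + 1, h⟩ =>
      X a ◁ tensorExtract X l ⟨i, Nat.lt_of_succ_lt_succ h⟩ ≫ (α_ _ _ _).inv ≫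
        (β_ (X a) _).hom ▷ _ ≫ (α_ _ _ _).hom

/-- The symmetry isomorphism `X a_1 ⊗ ... ⊗ X a_n ⟶ X a_{σ(1)} ⊗ ... ⊗ X a_{σ(n)}`. -/
def Reordering.permute (X : α → C) {l l' : List α} (σ : Reordering l l') :
    tensor X l ⟶ tensor X l' :=
  match σ with
  | .nil => 𝟙 (𝟙_ C)
  | .cons (l := l) i σ => tensorExtract X l i ≫ X (l.get i) ◁ σ.permute X

end Tensor

lemma Reordering.perm {α : Type*} {l l' : List α} (σ : Reordering l l') : l.Perm l' := by
  induction σ with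
  | nil => exact List.Perm.refl _
  | cons i σ ih => exact (List.getElem_cons_eraseIdx_perm i.2).symm.trans (ih.cons _)

lemma Reordering.exists_of_perm {α : Type*} {l l' : List α} (h : l.Perm l') :
    Nonempty (Reordering l l') := by
  induction l' generalizing l with
  | nil => rw [h.eq_nil]; exact ⟨.nil⟩
  | cons a l' ih =>
    obtain ⟨i, hi⟩ := List.get_of_mem (h.mem_iff.2 (List.mem_cons_self))
    subst hi
    obtain ⟨σ⟩ := ih (((List.getElem_cons_eraseIdx_perm i.2).trans h).cons_inv)
    exact ⟨.cons i σ⟩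

/-! ## Time-orderable tuples -/

/-- The `Loc`-morphisms with target `N`, together with their source. -/
abbrev Into (N : Loc.{u}) : Type (u + 1) := Σ M : Loc.{u}, (M ⟶ N)

variable {N : Loc.{u}}

/-- The images of the morphisms in the tuple are pairwise disjoint. -/
def IsPairwiseDisjoint (f : List (Into N)) : Prop :=
  f.Pairwise fun g h => Loc.image g.2 ∩ Loc.image h.2 = ∅

/-- `J⁺(f_i(M_i)) ∩ f_j(M_j) = ∅` for all `i < j`. -/
def IsTimeOrdered (f : List (Into N)) : Prop :=
  f.Pairwise fun g h => causalFuture (Loc.image g.2) ∩ Loc.image h.2 = ∅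

/-- A tuple of pairwise disjoint morphisms that has a time-ordering permutation. -/
def IsTimeOrderable (f : List (Into N)) : Prop :=
  IsPairwiseDisjoint f ∧ ∃ (f' : List (Into N)) (_ : Reordering f f'), IsTimeOrdered f'

lemma isTimeOrderable_iff {f : List (Into N)} :
    IsTimeOrderable f ↔ ∃ f' : List (Into N), f.Perm f' ∧ IsTimeOrdered f' := by
  constructor
  · rintro ⟨-, f', σ, h⟩; exact ⟨f', σ.perm, h⟩
  · rintro ⟨f', hp, h⟩
    refine ⟨(hp.pairwise_iff fun {a b} hab => ?_).2 (List.Pairwise.imp (fun {a b} hab => ?_) h),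
      f', (Reordering.exists_of_perm hp).some, h⟩
    · rw [Set.inter_comm]; exact hab
    · refine Set.subset_empty_iff.1 (hab ▸ Set.inter_subset_inter_left _ ?_)
      exact fun x hx => ⟨x, hx, Or.inl rfl⟩

/-- Time-orderable tuples `f = (f_1, ..., f_n) : M ⟶ N` of pairwise disjoint morphisms. -/
abbrev Tuple (N : Loc.{u}) : Type (u + 1) := {f : List (Into N) // IsTimeOrderable f}

namespace Tuple

/-- The empty tuple. -/
def empty (N : Loc.{u}) : Tuple N := ⟨[], isTimeOrderable_iff.2 ⟨[], .refl _, .nil⟩⟩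

/-- The tuple with the single entry `f`. -/
def single {M N : Loc.{u}} (f : M ⟶ N) : Tuple N :=
  ⟨[⟨M, f⟩], isTimeOrderable_iff.2 ⟨[⟨M, f⟩], .refl _, List.pairwise_singleton _ _⟩⟩

/-- The right permutation `fσ = (f_{σ(1)}, ..., f_{σ(n)})`. -/
def reorder (f : Tuple N) {f' : List (Into N)} (σ : Reordering f.1 f') : Tuple N :=
  ⟨f', by
    obtain ⟨f'', hp, h⟩ := isTimeOrderable_iff.1 f.2
    exact isTimeOrderable_iff.2 ⟨f'', σ.perm.symm.trans hp, h⟩⟩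

/-- The family of pairs `(f_1, g_1), ..., (f_n, g_n)`, where `g_i` is a time-orderable tuple with
target the source of `f_i`, for a time-orderable tuple `f`. -/
abbrev Nested (N : Loc.{u}) : Type (u + 1) :=
  {h : List (Σ f : Into N, Tuple f.1) // IsTimeOrderable (h.map Sigma.fst)}

/-- The outer tuple `f`. -/
def Nested.outer (h : Nested N) : Tuple N := ⟨h.1.map Sigma.fst, h.2⟩

/-- `g ↦ f ∘ g`. -/
def after (f : Into N) (g : Into f.1) : Into N := ⟨g.1, g.2 ≫ f.2⟩

lemma exists_perm_map_eq {α β : Type*} (u : α → β) {l : List α} {l' : List β}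
    (h : (l.map u).Perm l') : ∃ k : List α, l.Perm k ∧ k.map u = l' := by
  induction l' generalizing l with
  | nil => exact ⟨l, .refl _, h.eq_nil⟩
  | cons b l' ih =>
    obtain ⟨a, ha, rfl⟩ := List.mem_map.1 (h.mem_iff.2 List.mem_cons_self)
    obtain ⟨s, t, rfl⟩ := List.append_of_mem ha
    have hp : (s ++ a :: t).Perm (a :: (s ++ t)) := List.perm_middle
    obtain ⟨k, hk, rfl⟩ := ih (l := s ++ t) (((hp.map u).symm.trans h).cons_inv)
    exact ⟨a :: k, hp.trans (hk.cons a), rfl⟩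

lemma image_after_subset (f : Into N) (g : Into f.1) :
    Loc.image (after f g).2 ⊆ Loc.image f.2 := by
  rintro _ ⟨x, rfl⟩; exact ⟨g.2.toFun x, rfl⟩

/-- The composition `f(g_1, ..., g_n) = (f_1 g_{11}, ..., f_n g_{n k_n})`, which is again
time-orderable. -/
def Nested.comp (h : Nested N) : Tuple N :=
  ⟨h.1.flatMap fun p => p.2.1.map (after p.1), by
    obtain ⟨h, hh⟩ := h
    obtain ⟨f', hp, hf'⟩ := isTimeOrderable_iff.1 hh
    obtain ⟨k, hk, rfl⟩ := exists_perm_map_eq _ hp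
    choose o ho ho' using fun p : (Σ f : Into N, Tuple f.1) => isTimeOrderable_iff.1 p.2.2
    refine isTimeOrderable_iff.2 ⟨k.flatMap fun p => (o p).map (after p.1),
      hk.flatMap fun p _ => (ho p).map _, ?_⟩
    refine List.pairwise_flatMap.2 ⟨fun p _ => List.pairwise_map.2 ((ho' p).imp ?_),
      (List.pairwise_map.1 hf').imp ?_⟩
    · intro g g' hg
      refine Set.eq_empty_iff_forall_notMem.2 ?_
      rintro _ ⟨⟨_, ⟨x, rfl⟩, hx⟩, ⟨y, rfl⟩⟩
      exact Set.eq_empty_iff_forall_notMem.1 hg (g'.2.toFun y)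
        ⟨⟨_, ⟨x, rfl⟩, p.1.2.causallyPrecedes_of_map hx⟩, ⟨y, rfl⟩⟩
    · intro p q hpq a ha b hb
      obtain ⟨g, -, rfl⟩ := List.mem_map.1 ha
      obtain ⟨g', -, rfl⟩ := List.mem_map.1 hb
      refine Set.subset_empty_iff.1 (hpq ▸ Set.inter_subset_inter ?_ (image_after_subset _ _))
      rintro z ⟨x, hx, hxz⟩
      exact ⟨x, image_after_subset _ _ hx, hxz⟩⟩

end Tuple

/-! ## Time-orderable prefactorization algebras and algebraic quantum field theories -/

section Theories

variable (C : Type w) [Category.{v} C] [MonoidalCategory C]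

/-- The data of a time-orderable prefactorization algebra: an object `F(M)` for each `M`, and a
time-ordered product `F(f) : ⊗_i F(M_i) ⟶ F(N)` for each time-orderable tuple `f : M ⟶ N`. -/
structure PreTPFA where
  obj : Loc.{u} → C
  prod : ∀ {N : Loc.{u}} (f : Tuple N), tensor (fun g : Into N => obj g.1) f.1 ⟶ obj N

variable {C}

/-- A family `ζ_M : F(M) ⟶ G(M)` is compatible with the time-ordered products. -/
def PreTPFA.IsHom (F G : PreTPFA.{u} C) (ζ : ∀ M : Loc.{u}, F.obj M ⟶ G.obj M) : Prop :=
  ∀ (N : Loc.{u}) (f : Tuple N),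
    F.prod f ≫ ζ N = tensorMap (fun g : Into N => ζ g.1) f.1 ≫ G.prod f

/-- The inner products `⊗_i ⊗_j F(L_{ij}) ⟶ ⊗_i F(M_i)` followed by the outer product
`⊗_i F(M_i) ⟶ F(N)`. -/
def PreTPFA.nestedProd (F : PreTPFA.{u} C) {N : Loc.{u}} (h : Tuple.Nested N) :
    tensor (fun p : (Σ f : Into N, Tuple f.1) =>
      tensor (fun g : Into p.1.1 => F.obj g.1) p.2.1) h.1 ⟶ F.obj N :=
  tensorMap (fun p : (Σ f : Into N, Tuple f.1) => F.prod p.2) h.1 ≫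
    tensorReindex (fun f : Into N => F.obj f.1) Sigma.fst h.1 ≫ F.prod h.outer

/-- The rebracketing `⊗_i ⊗_j F(L_{ij}) ⟶ F(L_{11}) ⊗ ... ⊗ F(L_{n k_n})`. -/
def PreTPFA.nestedFlatten (F : PreTPFA.{u} C) {N : Loc.{u}} (h : Tuple.Nested N) :
    tensor (fun p : (Σ f : Into N, Tuple f.1) =>
      tensor (fun g : Into p.1.1 => F.obj g.1) p.2.1) h.1 ⟶
    tensor (fun g : Into N => F.obj g.1) h.comp.1 :=
  tensorMap (fun p : (Σ f : Into N, Tuple f.1) =>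
      tensorReindex (fun g : Into N => F.obj g.1) (Tuple.after p.1) p.2.1) h.1 ≫
    tensorFlatten (fun g : Into N => F.obj g.1)
      (fun p : (Σ f : Into N, Tuple f.1) => p.2.1.map (Tuple.after p.1)) h.1

variable [SymmetricCategory C]

/-- The axioms of a time-orderable prefactorization algebra. -/
structure PreTPFA.IsTPFA (F : PreTPFA.{u} C) : Prop where
  /-- `F(f) ∘ ⊗_i F(g_i) = F(f(g_1, ..., g_n))` -/
  comp : ∀ {N : Loc.{u}} (h : Tuple.Nested N),
    F.nestedProd h = F.nestedFlatten h ≫ F.prod h.comp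
  /-- `F(id_M) = id`, up to the identification `F(M) ⊗ I ≅ F(M)` -/
  id : ∀ M : Loc.{u}, F.prod (Tuple.single (𝟙 M)) = (ρ_ (F.obj M)).hom
  /-- equivariance under permutations -/
  perm : ∀ {N : Loc.{u}} (f : Tuple N) {f' : List (Into N)} (σ : Reordering f.1 f'),
    σ.permute (fun g : Into N => F.obj g.1) ≫ F.prod (f.reorder σ) = F.prod f

variable (C) in
/-- Time-orderable prefactorization algebras on `Loc` with values in `C`. -/
structure TPFA extends PreTPFA.{u} C where
  isTPFA : toPreTPFA.IsTPFA

namespace TPFA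

/-- Morphisms of time-orderable prefactorization algebras. -/
@[ext]
structure Hom (F G : TPFA.{u} C) where
  app : ∀ M : Loc.{u}, F.obj M ⟶ G.obj M
  isHom : F.toPreTPFA.IsHom G.toPreTPFA app

instance : Category (TPFA.{u} C) where
  Hom := Hom
  id F := ⟨fun M => 𝟙 (F.obj M), fun N f => by
    rw [Category.comp_id, tensorMap_id]; exact (Category.id_comp _).symm⟩
  comp ζ ξ := ⟨fun M => ζ.app M ≫ ξ.app M, fun N f => by
    rw [tensorMap_comp, Category.assoc, ← ξ.isHom, ← Category.assoc, ζ.isHom, Category.assoc]⟩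

end TPFA

/-- Einstein causality: for causally disjoint `f₁ ⊥ f₂`, the multiplication and the opposite
multiplication agree after `A(f₁) ⊗ A(f₂)`. -/
def EinsteinCausality : ObjectProperty (Loc.{u} ⥤ Mon C) := fun A =>
  ∀ {M₁ M₂ N : Loc.{u}} (f₁ : M₁ ⟶ N) (f₂ : M₂ ⟶ N),
    CausallyDisjoint (Loc.image f₁) (Loc.image f₂) →
    ((A.map f₁).hom ⊗ₘ (A.map f₂).hom) ≫ μ[(A.obj N).X] =
      ((A.map f₁).hom ⊗ₘ (A.map f₂).hom) ≫ (β_ (A.obj N).X (A.obj N).X).hom ≫ μ[(A.obj N).X]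

variable (C) in
/-- The category of algebraic quantum field theories on `Loc` with values in `C`: functors to
associative and unital algebras satisfying Einstein causality, with natural transformations. -/
abbrev AQFT := (EinsteinCausality.{u} (C := C)).FullSubcategory

namespace AQFT

/-- `⊗_i A(M_i) ⟶ ⊗_i A(M_{ρ(i)}) ⟶ A(N) ⊗ ... ⊗ A(N) ⟶ A(N)`: permute the factors, apply
`⊗_i A(f_{ρ(i)})`, and multiply in the given order. -/
def orderedProd (A : AQFT.{u} C) {N : Loc.{u}} {f f' : List (Into N)} (ρ : Reordering f f') :
    tensor (fun g : Into N => (A.obj.obj g.1).X) f ⟶ (A.obj.obj N).X :=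
  ρ.permute (fun g : Into N => (A.obj.obj g.1).X) ≫
    tensorMap (fun g : Into N => (A.obj.map g.2).hom) f' ≫ naryMul (A.obj.obj N) f'

/-- The objects `A(M)`, and the time-ordered products formed with some choice of a time-ordering
permutation of each time-orderable tuple. -/
def toPreTPFA (A : AQFT.{u} C) : PreTPFA.{u} C where
  obj M := (A.obj.obj M).X
  prod f := A.orderedProd f.2.2.choose_spec.choose

end AQFT

end Theories

end LorentzQFT

end

open LorentzQFT

/-! If two time-orderings of one tuple disagree about the order of two entries, neither image meets
the causal future of the other. The images are then causally disjoint, and Einstein causality makes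
the two factors commute. `IsPermute.orderedMul_eq` turns this into an induction: the first factor of
one ordering is moved to the front of the other, past factors that all commute with it, and is then
split off. Hence a time-ordered product can be computed along any permutation to any time-ordered
list (`AQFT.prod_eq_comp_orderedMul`), and each axiom reduces to a suitable choice of permutation.

For equivariance, a time-ordering of `fσ` preceded by `σ` is a time-ordering of `f`. For
composition, time-order the outer tuple and every inner tuple; the concatenation is time-ordered
(`isTimeOrdered_flatMap`). Since each `A(f_i)` is an algebra homomorphism, both sides become the
same iterated product in `A(N)`. Morphisms of theories are compatible with these products because
they are natural and multiplicative.

The remaining work is coherence: permuting blocks and then permuting inside the blocks must be,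
after rebracketing, one permutation of all factors. The predicates `IsExtract` and `IsPermute`
recognise symmetry isomorphisms built by moving one factor after another to the front, so no index
permutation has to be computed. They follow positions rather than values, so repeated entries do no
harm. -/

namespace LorentzQFT

/-! ### Exchanging two neighbouring factors -/

section Swap

variable {C : Type w} [Category.{v} C] [MonoidalCategory C] [SymmetricCategory C]

/-- The symmetry isomorphism that exchanges the first two factors of `A ⊗ (B ⊗ Z)`. -/
def swapFront (A B Z : C) : A ⊗ B ⊗ Z ⟶ B ⊗ A ⊗ Z :=
  (α_ A B Z).inv ≫ (β_ A B).hom ▷ Z ≫ (α_ B A Z).hom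

lemma swapFront_natural {A A' B B' Z Z' : C} (f : A ⟶ A') (g : B ⟶ B') (h : Z ⟶ Z') :
    (f ⊗ₘ g ⊗ₘ h) ≫ swapFront A' B' Z' = swapFront A B Z ≫ (g ⊗ₘ f ⊗ₘ h) := by
  simp only [swapFront, Category.assoc, associator_inv_naturality_assoc]
  rw [← associator_naturality, ← tensorHom_id, ← tensorHom_id,
    tensorHom_comp_tensorHom_assoc, tensorHom_comp_tensorHom_assoc,
    BraidedCategory.braiding_naturality]
  simp

lemma swapFront_whisker (A B : C) {Z Z' : C} (h : Z ⟶ Z') :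
    A ◁ B ◁ h ≫ swapFront A B Z' = swapFront A B Z ≫ B ◁ A ◁ h := by
  simpa using swapFront_natural (𝟙 A) (𝟙 B) h

lemma swapFront_whisker_assoc (A B : C) {Z Z' W : C} (h : Z ⟶ Z') (k : B ⊗ A ⊗ Z' ⟶ W) :
    A ◁ B ◁ h ≫ swapFront A B Z' ≫ k = swapFront A B Z ≫ B ◁ A ◁ h ≫ k := by
  rw [← Category.assoc, swapFront_whisker, Category.assoc]

@[simp]
-- This is the symmetry axiom `β ∘ β = 1`, which a mere braiding need not satisfy.
lemma swapFront_swapFront (A B Z : C) : swapFront A B Z ≫ swapFront B A Z = 𝟙 _ := by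
  simp [swapFront, ← comp_whiskerRight_assoc]

lemma swapFront_yang_baxter (A B D Z : C) :
    A ◁ swapFront B D Z ≫ swapFront A D (B ⊗ Z) ≫ D ◁ swapFront A B Z =
      swapFront A B (D ⊗ Z) ≫ B ◁ swapFront A D Z ≫ swapFront B D (A ⊗ Z) := by
  -- The extra factor `Z` is only a spectator: tensor the Yang–Baxter equation for `A`, `B`, `D`
  -- with it and rebracket.
  have h := congrArg (fun t => 𝟙 (A ⊗ B ⊗ D ⊗ Z) ⊗≫ t ▷ Z ⊗≫ 𝟙 (D ⊗ B ⊗ A ⊗ Z))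
    (BraidedCategory.yang_baxter A B D)
  calc
    _ = 𝟙 _ ⊗≫ (A ◁ (β_ B D).hom ≫ (α_ A D B).inv ≫ (β_ A D).hom ▷ B ≫ (α_ D A B).hom ≫
          D ◁ (β_ A B).hom) ▷ Z ⊗≫ 𝟙 _ := by
      unfold swapFront; monoidal
    _ = _ := h.symm
    _ = _ := by unfold swapFront; monoidal

/-- The hexagon identity: a composite factor is crossed one constituent at a time. This and the next
lemma drive the inductions over blocks. -/
lemma swapFront_tensor_left (A A' B Z : C) :
    swapFront (A ⊗ A') B Z = (α_ A A' (B ⊗ Z)).hom ≫ A ◁ swapFront A' B Z ≫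
      swapFront A B (A' ⊗ Z) ≫ B ◁ (α_ A A' Z).inv := by
  simp [swapFront, BraidedCategory.braiding_tensor_left_hom]

lemma swapFront_tensor_right (A B B' Z : C) :
    swapFront A (B ⊗ B') Z = A ◁ (α_ B B' Z).hom ≫ swapFront A B (B' ⊗ Z) ≫
      B ◁ swapFront A B' Z ≫ (α_ B B' (A ⊗ Z)).inv := by
  simp [swapFront, BraidedCategory.braiding_tensor_right_hom]

lemma swapFront_unit_left (B Z : C) :
    swapFront (𝟙_ C) B Z = (λ_ (B ⊗ Z)).hom ≫ B ◁ (λ_ Z).inv := by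
  simp [swapFront]

lemma swapFront_unit_right (A Z : C) :
    swapFront A (𝟙_ C) Z = A ◁ (λ_ Z).hom ≫ (λ_ (A ⊗ Z)).inv := by
  simp [swapFront]

end Swap

/-! ### Permutations of factors, as a predicate on morphisms -/

section Extract

variable {C : Type w} [Category.{v} C] [MonoidalCategory C] [SymmetricCategory C] {α β : Type*}

/-- The morphism `x` is a symmetry isomorphism that moves one factor `X a` of a tensor product over
`l` to the front, with `m` the list of the other factors in their given order. -/
inductive IsExtract (X : α → C) (a : α) : (l m : List α) →
    (tensor X l ⟶ X a ⊗ tensor X m) → Prop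
  | head (l : List α) : IsExtract X a (a :: l) l (𝟙 (X a ⊗ tensor X l))
  | tail {l m : List α} (b : α) {x : tensor X l ⟶ X a ⊗ tensor X m}
      (hx : IsExtract X a l m x) :
      IsExtract X a (b :: l) (b :: m) (X b ◁ x ≫ swapFront (X b) (X a) (tensor X m))

/-- The morphism `p` is a symmetry isomorphism that permutes the factors of a tensor product. -/
inductive IsPermute (X : α → C) : (l l' : List α) → (tensor X l ⟶ tensor X l') → Prop
  | nil : IsPermute X [] [] (𝟙 (𝟙_ C))
  | cons {a : α} {l m l' : List α} {x : tensor X l ⟶ X a ⊗ tensor X m}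
      {p : tensor X m ⟶ tensor X l'} (hx : IsExtract X a l m x) (hp : IsPermute X m l' p) :
      IsPermute X l (a :: l') (x ≫ X a ◁ p)

variable {X Y : α → C}

/-- Passage from explicit positions to the predicate. The recursive clause of `tensorExtract` is a
`swapFront` by definition. -/
lemma tensorExtract_isExtract (X : α → C) : ∀ (l : List α) (i : Fin l.length),
    IsExtract X (l.get i) l (l.eraseIdx i) (tensorExtract X l i)
  | [], i => i.elim0
  | _ :: l, ⟨0, _⟩ => .head l
  | a :: l, ⟨i + 1, h⟩ =>
      .tail a (tensorExtract_isExtract X l ⟨i, Nat.lt_of_succ_lt_succ h⟩)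

lemma Reordering.isPermute (X : α → C) {l l' : List α} (σ : Reordering l l') :
    IsPermute X l l' (σ.permute X) := by
  induction σ with
  | nil => exact .nil
  | cons i σ ih => exact .cons (tensorExtract_isExtract X _ i) ih

lemma IsExtract.perm {a : α} {l m : List α} {x : tensor X l ⟶ X a ⊗ tensor X m}
    (hx : IsExtract X a l m x) : l.Perm (a :: m) := by
  induction hx with
  | head l => exact .refl _
  | tail b _ ih => exact (ih.cons b).trans (.swap _ _ _)

lemma IsExtract.sublist {a : α} {l m : List α} {x : tensor X l ⟶ X a ⊗ tensor X m}
    (hx : IsExtract X a l m x) : m.Sublist l := by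
  induction hx with
  | head l => exact List.sublist_cons_self a l
  | tail b _ ih => exact ih.cons_cons b

lemma IsPermute.perm {l l' : List α} {p : tensor X l ⟶ tensor X l'} (hp : IsPermute X l l' p) :
    l.Perm l' := by
  induction hp with
  | nil => exact .refl _
  | cons hx _ ih => exact hx.perm.trans (ih.cons _)

lemma IsPermute.refl (X : α → C) : ∀ l : List α, IsPermute X l l (𝟙 (tensor X l))
  | [] => .nil
  | _ :: l => by
      have key {A M : C} : 𝟙 (A ⊗ M) ≫ A ◁ 𝟙 M = 𝟙 (A ⊗ M) := by simp
      exact key ▸ IsPermute.cons (.head l) (IsPermute.refl X l)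

/-- Two successive extractions can be made in the opposite order. -/
lemma IsExtract.exchange {a b : α} {l m n : List α} {x : tensor X l ⟶ X a ⊗ tensor X m}
    {y : tensor X m ⟶ X b ⊗ tensor X n} (hx : IsExtract X a l m x) (hy : IsExtract X b m n y) :
    ∃ (k : List α) (y' : tensor X l ⟶ X b ⊗ tensor X k) (x' : tensor X k ⟶ X a ⊗ tensor X n),
      IsExtract X b l k y' ∧ IsExtract X a k n x' ∧
      x ≫ X a ◁ y ≫ swapFront (X a) (X b) (tensor X n) = y' ≫ X b ◁ x' := by
  induction hx generalizing n with
  | head l =>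
    refine ⟨a :: n, _, _, .tail a hy, .head n, ?_⟩
    -- Here and below, `key` is the identity for arbitrary objects; the goal is an instance of it
    -- once `tensor` is unfolded on a nonempty list.
    have key {A B M N : C} (y : M ⟶ B ⊗ N) : 𝟙 (A ⊗ M) ≫ A ◁ y ≫ swapFront A B N =
        (A ◁ y ≫ swapFront A B N) ≫ B ◁ 𝟙 (A ⊗ N) := by simp
    exact key _
  | @tail l m c x hx ih =>
    cases hy with
    | head _ =>
      refine ⟨l, _, _, .head l, hx, ?_⟩
      have key {A D L M : C} (x : L ⟶ A ⊗ M) :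
          (D ◁ x ≫ swapFront D A M) ≫ A ◁ 𝟙 (D ⊗ M) ≫ swapFront A D M =
            𝟙 (D ⊗ L) ≫ D ◁ x := by simp
      exact key _
    | @tail _ n _ y hy =>
      obtain ⟨k, y', x', hy', hx', h⟩ := ih hy
      refine ⟨c :: k, _, _, .tail c hy', .tail c hx', ?_⟩
      have key {A B D L M N K : C} (x : L ⟶ A ⊗ M) (y : M ⟶ B ⊗ N) (y' : L ⟶ B ⊗ K)
          (x' : K ⟶ A ⊗ N) (h : x ≫ A ◁ y ≫ swapFront A B N = y' ≫ B ◁ x') :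
          (D ◁ x ≫ swapFront D A M) ≫ A ◁ (D ◁ y ≫ swapFront D B N) ≫ swapFront A B (D ⊗ N) =
            (D ◁ y' ≫ swapFront D B K) ≫ B ◁ (D ◁ x' ≫ swapFront D A N) := by
        -- Both extracted factors have to cross the head `c`; Yang–Baxter says that the order of the
        -- two crossings does not matter.
        have hs := swapFront_yang_baxter D A B N
        rw [MonoidalCategory.whiskerLeft_comp, MonoidalCategory.whiskerLeft_comp, Category.assoc,
          Category.assoc, Category.assoc, ← swapFront_whisker_assoc, ← swapFront_whisker_assoc,
          ← hs, ← MonoidalCategory.whiskerLeft_comp_assoc,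
          ← MonoidalCategory.whiskerLeft_comp_assoc, Category.assoc, h]
        simp
      exact key x y y' x' h

/-- Two extractions from the same list either coincide or can be made one after the other, in
either order. -/
lemma IsExtract.eq_or_exchange {a b : α} {l m n : List α} {x : tensor X l ⟶ X a ⊗ tensor X m}
    {y : tensor X l ⟶ X b ⊗ tensor X n} (hx : IsExtract X a l m x) (hy : IsExtract X b l n y) :
    (∃ (hab : a = b) (hmn : m = n), x ≫ eqToHom (by rw [hab, hmn]) = y) ∨
    ∃ (k : List α) (y' : tensor X m ⟶ X b ⊗ tensor X k) (x' : tensor X n ⟶ X a ⊗ tensor X k),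
      IsExtract X b m k y' ∧ IsExtract X a n k x' ∧
      x ≫ X a ◁ y' = y ≫ X b ◁ x' ≫ swapFront (X b) (X a) (tensor X k) := by
  induction hx generalizing n with
  | head l =>
    cases hy with
    | head _ => exact .inl ⟨rfl, rfl, Category.comp_id _⟩
    | @tail _ n _ y hy =>
      refine .inr ⟨n, _, _, hy, .head _, ?_⟩
      have key {A B M N : C} (y : M ⟶ B ⊗ N) : 𝟙 (A ⊗ M) ≫ A ◁ y =
          (A ◁ y ≫ swapFront A B N) ≫ B ◁ 𝟙 (A ⊗ N) ≫ swapFront B A N := by simp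
      exact key _
  | @tail l m c x hx ih =>
    cases hy with
    | head _ =>
      refine .inr ⟨m, _, _, .head _, hx, ?_⟩
      have key {A D L M : C} (x : L ⟶ A ⊗ M) : (D ◁ x ≫ swapFront D A M) ≫ A ◁ 𝟙 (D ⊗ M) =
          𝟙 (D ⊗ L) ≫ D ◁ x ≫ swapFront D A M := by simp
      exact key _
    | @tail _ n _ y hy =>
      obtain ⟨rfl, rfl, h⟩ | ⟨k, y', x', hy', hx', h⟩ := ih hy
      · refine .inl ⟨rfl, rfl, ?_⟩
        rw [eqToHom_refl, Category.comp_id] at h ⊢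
        rw [h]
      · refine .inr ⟨c :: k, _, _, .tail c hy', .tail c hx', ?_⟩
        have key {A B D L M N K : C} (x : L ⟶ A ⊗ M) (y : L ⟶ B ⊗ N) (y' : M ⟶ B ⊗ K)
            (x' : N ⟶ A ⊗ K) (h : x ≫ A ◁ y' = y ≫ B ◁ x' ≫ swapFront B A K) :
            (D ◁ x ≫ swapFront D A M) ≫ A ◁ (D ◁ y' ≫ swapFront D B K) =
              (D ◁ y ≫ swapFront D B N) ≫ B ◁ (D ◁ x' ≫ swapFront D A K) ≫
                swapFront B A (D ⊗ K) := by
          have hs := swapFront_yang_baxter D B A K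
          simp only [MonoidalCategory.whiskerLeft_comp, Category.assoc]
          rw [← swapFront_whisker_assoc, ← swapFront_whisker_assoc, ← hs,
            ← MonoidalCategory.whiskerLeft_comp_assoc, h]
          simp
        exact key x y y' x' h

/-- A factor of the target of a permutation comes from a factor of its source. -/
lemma IsPermute.exists_extract_source {a : α} {l l' m' : List α} {p : tensor X l ⟶ tensor X l'}
    {x : tensor X l' ⟶ X a ⊗ tensor X m'} (hp : IsPermute X l l' p)
    (hx : IsExtract X a l' m' x) :
    ∃ (m : List α) (y : tensor X l ⟶ X a ⊗ tensor X m) (q : tensor X m ⟶ tensor X m'),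
      IsExtract X a l m y ∧ IsPermute X m m' q ∧ p ≫ x = y ≫ X a ◁ q := by
  induction hp generalizing m' with
  | nil => nomatch hx
  | @cons b l n l' z p hz hp ih =>
    cases hx with
    | head _ => exact ⟨n, z, p, hz, hp, Category.comp_id _⟩
    | @tail _ m' _ x hx =>
      obtain ⟨m, y, q, hy, hq, h⟩ := ih hx
      -- The factor `a` is found after `b` has been extracted; exchanging the two extractions takes
      -- `a` out first.
      obtain ⟨k, y', z', hy', hz', h'⟩ := hz.exchange hy
      refine ⟨k, y', _, hy', .cons hz' hq, ?_⟩
      have key {A B L M N L' M' K : C} (z : L ⟶ B ⊗ N) (p : N ⟶ L') (x : L' ⟶ A ⊗ M')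
          (y : N ⟶ A ⊗ M) (q : M ⟶ M') (y' : L ⟶ A ⊗ K) (z' : K ⟶ B ⊗ M)
          (h : p ≫ x = y ≫ A ◁ q) (h' : z ≫ B ◁ y ≫ swapFront B A M = y' ≫ A ◁ z') :
          (z ≫ B ◁ p) ≫ B ◁ x ≫ swapFront B A M' = y' ≫ A ◁ (z' ≫ B ◁ q) := by
        rw [Category.assoc, ← MonoidalCategory.whiskerLeft_comp_assoc, h,
          MonoidalCategory.whiskerLeft_comp_assoc, swapFront_whisker,
          MonoidalCategory.whiskerLeft_comp, ← reassoc_of% h']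
      exact key z p x y q y' z' h h'

/-- A factor of the source of a permutation is mapped to a factor of its target. -/
lemma IsPermute.exists_extract_target {a : α} {l l' m : List α} {p : tensor X l ⟶ tensor X l'}
    {x : tensor X l ⟶ X a ⊗ tensor X m} (hp : IsPermute X l l' p) (hx : IsExtract X a l m x) :
    ∃ (m' : List α) (y : tensor X l' ⟶ X a ⊗ tensor X m') (q : tensor X m ⟶ tensor X m'),
      IsExtract X a l' m' y ∧ IsPermute X m m' q ∧ p ≫ y = x ≫ X a ◁ q := by
  induction hp generalizing m with
  | nil => nomatch hx
  | @cons b l n l' z p hz hp ih =>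
    -- Either the tracked factor is the one that `p` sends to the front, or it survives that
    -- extraction and is followed through the rest of `p`.
    obtain ⟨rfl, rfl, h⟩ | ⟨k, y', z', hy', hz', h⟩ := hx.eq_or_exchange hz
    · rw [eqToHom_refl, Category.comp_id] at h
      subst h
      exact ⟨l', _, p, .head _, hp, Category.comp_id _⟩
    · obtain ⟨m', y, q, hy, hq, h'⟩ := ih hz'
      refine ⟨b :: m', _, _, .tail b hy, .cons hy' hq, ?_⟩
      have key {A B L M N L' M' K : C} (z : L ⟶ B ⊗ N) (p : N ⟶ L') (x : L ⟶ A ⊗ M)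
          (y' : M ⟶ B ⊗ K) (z' : N ⟶ A ⊗ K) (y : L' ⟶ A ⊗ M') (q : K ⟶ M')
          (h : x ≫ A ◁ y' = z ≫ B ◁ z' ≫ swapFront B A K) (h' : p ≫ y = z' ≫ A ◁ q) :
          (z ≫ B ◁ p) ≫ B ◁ y ≫ swapFront B A M' = x ≫ A ◁ (y' ≫ B ◁ q) := by
        rw [Category.assoc, ← MonoidalCategory.whiskerLeft_comp_assoc, h',
          MonoidalCategory.whiskerLeft_comp_assoc, swapFront_whisker,
          MonoidalCategory.whiskerLeft_comp, reassoc_of% h]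
      exact key z p x y' z' y q h h'

/-- Induction on the second permutation: the factor it extracts first is traced back through the
first one, which leaves a smaller permutation to compose with. -/
lemma IsPermute.comp {l l' l'' : List α} {p : tensor X l ⟶ tensor X l'}
    {q : tensor X l' ⟶ tensor X l''} (hp : IsPermute X l l' p) (hq : IsPermute X l' l'' q) :
    IsPermute X l l'' (p ≫ q) := by
  induction hq generalizing l with
  | nil => exact (Category.comp_id p).symm ▸ hp
  | @cons a _ _ _ x q hx _ ih =>
    obtain ⟨m, y, r, hy, hr, h⟩ := hp.exists_extract_source hx
    have key {A L L' M M' L'' : C} (p : L ⟶ L') (x : L' ⟶ A ⊗ M') (q : M' ⟶ L'')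
        (y : L ⟶ A ⊗ M) (r : M ⟶ M') (h : p ≫ x = y ≫ A ◁ r) :
        y ≫ A ◁ (r ≫ q) = p ≫ x ≫ A ◁ q := by
      rw [MonoidalCategory.whiskerLeft_comp, ← reassoc_of% h]
    exact key p x q y r h ▸ IsPermute.cons hy (ih hr)

end Extract

/-! ### Ordered products in an algebra -/

section OrderedMul

variable {C : Type w} [Category.{v} C] [MonoidalCategory C] {α β : Type*} {X Y : α → C}

/-- `φ a₁ ⋯ φ aₙ`: apply `⊗ᵢ φ aᵢ`, and multiply in the given order. -/
noncomputable def orderedMul (A : Mon C) (φ : ∀ a, X a ⟶ A.X) (l : List α) : tensor X l ⟶ A.X :=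
  tensorMap φ l ≫ naryMul A l

lemma orderedMul_nil (A : Mon C) (φ : ∀ a, X a ⟶ A.X) : orderedMul A φ [] = η[A.X] :=
  Category.id_comp _

lemma orderedMul_cons (A : Mon C) (φ : ∀ a, X a ⟶ A.X) (a : α) (l : List α) :
    orderedMul A φ (a :: l) = (φ a ⊗ₘ orderedMul A φ l) ≫ μ[A.X] := by
  have key {B B' L L' : C} (f : B ⟶ B') (g : L ⟶ L') (h : L' ⟶ B') {D : C} (m : B' ⊗ B' ⟶ D) :
      (f ⊗ₘ g) ≫ B' ◁ h ≫ m = (f ⊗ₘ g ≫ h) ≫ m :=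
    tensorHom_comp_whiskerLeft_assoc _ _ _ _
  exact key _ _ _ _

lemma tensorMap_orderedMul (A : Mon C) (ξ : ∀ a, X a ⟶ Y a) (φ : ∀ a, Y a ⟶ A.X) (l : List α) :
    tensorMap ξ l ≫ orderedMul A φ l = orderedMul A (fun a => ξ a ≫ φ a) l := by
  rw [orderedMul, orderedMul, tensorMap_comp, Category.assoc]

lemma orderedMul_comp_hom {A B : Mon C} (φ : ∀ a, X a ⟶ A.X) (κ : A ⟶ B) (l : List α) :
    orderedMul A φ l ≫ κ.hom = orderedMul B (fun a => φ a ≫ κ.hom) l := by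
  induction l with
  | nil => rw [orderedMul_nil, orderedMul_nil]; exact IsMonHom.one_hom κ.hom
  | cons a l ih =>
    rw [orderedMul_cons, orderedMul_cons, ← ih]
    have key {D E : C} (f : D ⟶ A.X) (g : E ⟶ A.X) :
        ((f ⊗ₘ g) ≫ μ[A.X]) ≫ κ.hom = (f ≫ κ.hom ⊗ₘ g ≫ κ.hom) ≫ μ[B.X] := by
      rw [Category.assoc, IsMonHom.mul_hom, tensorHom_comp_tensorHom_assoc]
    exact key _ _

lemma tensorReindex_orderedMul (A : Mon C) (φ : ∀ a, X a ⟶ A.X) (u : β → α) (l : List β) :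
    tensorReindex X u l ≫ orderedMul A φ (l.map u) = orderedMul A (fun b => φ (u b)) l := by
  induction l with
  | nil => exact Category.id_comp _
  | cons b l ih =>
    rw [orderedMul_cons _ _ b, ← ih]
    refine (congrArg (tensorReindex X u (b :: l) ≫ ·)
      (orderedMul_cons A φ (u b) (l.map u))).trans ?_
    have key {B B' L L' : C} (f : B ⟶ B') (g : L ⟶ L') (h : L' ⟶ B') {D : C} (m : B' ⊗ B' ⟶ D) :
        B ◁ g ≫ (f ⊗ₘ h) ≫ m = (f ⊗ₘ g ≫ h) ≫ m :=
      whiskerLeft_comp_tensorHom_assoc _ _ _ _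
    exact key _ _ _ _

/-- Associativity for two blocks of factors, by induction on the first; the empty block is the unit
law. -/
lemma tensorAppend_orderedMul (A : Mon C) (φ : ∀ a, X a ⟶ A.X) (l l' : List α) :
    tensorAppend X l l' ≫ orderedMul A φ (l ++ l') =
      (orderedMul A φ l ⊗ₘ orderedMul A φ l') ≫ μ[A.X] := by
  induction l with
  | nil =>
    rw [orderedMul_nil]
    have key {L : C} (f : L ⟶ A.X) : (λ_ L).hom ≫ f = (η[A.X] ⊗ₘ f) ≫ μ[A.X] := by
      rw [MonoidalCategory.tensorHom_def']; simp
    exact key _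
  | cons a l ih =>
    rw [orderedMul_cons]
    refine (congrArg (tensorAppend X (a :: l) l' ≫ ·) (orderedMul_cons A φ a (l ++ l'))).trans ?_
    have key {B L L' L'' : C} (t : L ⊗ L' ⟶ L'') (f : B ⟶ A.X) (g : L ⟶ A.X) (h : L' ⟶ A.X)
        (k : L'' ⟶ A.X) (ih : t ≫ k = (g ⊗ₘ h) ≫ μ[A.X]) :
        ((α_ B L L').hom ≫ B ◁ t) ≫ (f ⊗ₘ k) ≫ μ[A.X] =
          (((f ⊗ₘ g) ≫ μ[A.X]) ⊗ₘ h) ≫ μ[A.X] := by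
      have h1 : B ◁ t ≫ (f ⊗ₘ k) = (f ⊗ₘ g ⊗ₘ h) ≫ A.X ◁ μ[A.X] := by
        rw [whiskerLeft_comp_tensorHom, ih, tensorHom_comp_whiskerLeft]
      have h2 : (((f ⊗ₘ g) ≫ μ[A.X]) ⊗ₘ h) = ((f ⊗ₘ g) ⊗ₘ h) ≫ μ[A.X] ▷ A.X :=
        (tensorHom_comp_whiskerRight _ _ _).symm
      rw [Category.assoc, reassoc_of% h1, h2, Category.assoc, MonObj.mul_assoc,
        associator_naturality_assoc]
    exact key _ _ _ _ _ ih

lemma tensorFlatten_orderedMul (A : Mon C) (φ : ∀ a, X a ⟶ A.X) (u : β → List α) (l : List β) :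
    tensorFlatten X u l ≫ orderedMul A φ (l.flatMap u) =
      orderedMul A (fun b => orderedMul A φ (u b)) l := by
  induction l with
  | nil => exact Category.id_comp _
  | cons b l ih =>
    rw [orderedMul_cons, ← ih]
    have key {B L L' L'' : C} (g : L ⟶ L') (t : B ⊗ L' ⟶ L'') (f : B ⟶ A.X) (h : L' ⟶ A.X)
        (k : L'' ⟶ A.X) (h' : t ≫ k = (f ⊗ₘ h) ≫ μ[A.X]) :
        (B ◁ g ≫ t) ≫ k = (f ⊗ₘ g ≫ h) ≫ μ[A.X] := by
      rw [Category.assoc, h', whiskerLeft_comp_tensorHom_assoc]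
    exact key _ _ _ _ _ (tensorAppend_orderedMul A φ _ _)

variable [SymmetricCategory C]

/-- On its way to the front, `a` crosses only factors `b` that precede it in `l`. These satisfy `R b
a` because `l` is ordered, and `R a b` by `ha`, so `a` commutes with each of them. -/
lemma IsExtract.comp_orderedMul (A : Mon C) (φ : ∀ a, X a ⟶ A.X) {R : α → α → Prop}
    (hR : ∀ a b, R a b → R b a →
      (φ a ⊗ₘ φ b) ≫ μ[A.X] = (φ a ⊗ₘ φ b) ≫ (β_ A.X A.X).hom ≫ μ[A.X])
    {a : α} {l m : List α} {x : tensor X l ⟶ X a ⊗ tensor X m} (hx : IsExtract X a l m x)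
    (hl : l.Pairwise R) (ha : ∀ b ∈ m, R a b) :
    x ≫ (φ a ⊗ₘ orderedMul A φ m) ≫ μ[A.X] = orderedMul A φ l := by
  induction hx with
  | head l => rw [orderedMul_cons]; exact Category.id_comp _
  | @tail l m b x hx ih =>
    rw [List.pairwise_cons] at hl
    have h := ih hl.2 fun c hc => ha c (List.mem_cons_of_mem _ hc)
    have hc := hR b a (hl.1 a (hx.perm.mem_iff.2 List.mem_cons_self)) (ha b List.mem_cons_self)
    rw [orderedMul_cons, orderedMul_cons, ← h]
    have key {B D L M : C} (x : L ⟶ B ⊗ M) (f : B ⟶ A.X) (g : D ⟶ A.X) (k : M ⟶ A.X)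
        (hc : (g ⊗ₘ f) ≫ μ[A.X] = (g ⊗ₘ f) ≫ (β_ A.X A.X).hom ≫ μ[A.X]) :
        (D ◁ x ≫ swapFront D B M) ≫ (f ⊗ₘ ((g ⊗ₘ k) ≫ μ[A.X])) ≫ μ[A.X] =
          (g ⊗ₘ (x ≫ (f ⊗ₘ k) ≫ μ[A.X])) ≫ μ[A.X] := by
      -- Associativity brings the two neighbours together. It is stated for both orders, so that
      -- commutativity can be applied between its two uses.
      have h1 (B₁ B₂ : C) (f₁ : B₁ ⟶ A.X) (f₂ : B₂ ⟶ A.X) :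
          (f₁ ⊗ₘ ((f₂ ⊗ₘ k) ≫ μ[A.X])) ≫ μ[A.X] =
            (α_ B₁ B₂ M).inv ≫ ((f₁ ⊗ₘ f₂) ≫ μ[A.X] ⊗ₘ k) ≫ μ[A.X] := by
        have h2 : (((f₁ ⊗ₘ f₂) ≫ μ[A.X]) ⊗ₘ k) = ((f₁ ⊗ₘ f₂) ⊗ₘ k) ≫ μ[A.X] ▷ A.X :=
          (tensorHom_comp_whiskerRight _ _ _).symm
        have h3 : (f₁ ⊗ₘ ((f₂ ⊗ₘ k) ≫ μ[A.X])) = (f₁ ⊗ₘ f₂ ⊗ₘ k) ≫ A.X ◁ μ[A.X] :=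
          (tensorHom_comp_whiskerLeft _ _ _).symm
        rw [h2, h3, Category.assoc, Category.assoc, MonObj.mul_assoc,
          associator_naturality_assoc, Iso.inv_hom_id_assoc]
      have h4 : (g ⊗ₘ (x ≫ (f ⊗ₘ k) ≫ μ[A.X])) = D ◁ x ≫ (g ⊗ₘ ((f ⊗ₘ k) ≫ μ[A.X])) :=
        (whiskerLeft_comp_tensorHom _ _ _).symm
      rw [h4, Category.assoc, Category.assoc, h1, h1, hc, swapFront,
        BraidedCategory.braiding_naturality_assoc, Category.assoc, Category.assoc,
        Iso.hom_inv_id_assoc, whiskerRight_comp_tensorHom_assoc]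
    exact key _ _ _ _ hc

/-- The product in an order compatible with `R` does not depend on the order, if the factors that
`R` does not order strictly commute with each other. -/
lemma IsPermute.orderedMul_eq (A : Mon C) (φ : ∀ a, X a ⟶ A.X) {R : α → α → Prop}
    (hR : ∀ a b, R a b → R b a →
      (φ a ⊗ₘ φ b) ≫ μ[A.X] = (φ a ⊗ₘ φ b) ≫ (β_ A.X A.X).hom ≫ μ[A.X])
    {l l' l'' : List α} {p : tensor X l ⟶ tensor X l'} {q : tensor X l ⟶ tensor X l''}
    (hp : IsPermute X l l' p) (hq : IsPermute X l l'' q)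
    (hl' : l'.Pairwise R) (hl'' : l''.Pairwise R) :
    p ≫ orderedMul A φ l' = q ≫ orderedMul A φ l'' := by
  induction hp generalizing l'' with
  | nil =>
    cases hq with
    | nil => rfl
    | cons hx _ => nomatch hx
  | @cons a l m l' x p hx hp ih =>
    -- Locate in `l''` the factor that heads the other ordering.
    obtain ⟨m', y, r, hy, hr, h⟩ := hq.exists_extract_target hx
    rw [List.pairwise_cons] at hl'
    -- Deleting a factor leaves a sublist, which is still ordered by `R`.
    have h1 := ih hr hl'.2 (hl''.sublist hy.sublist)
    have h2 := hy.comp_orderedMul A φ hR hl'' fun b hb =>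
      hl'.1 b ((hp.perm.symm.trans hr.perm).mem_iff.2 hb)
    rw [← h2, orderedMul_cons]
    have key {B L L'' M M' M'' : C} (x : L ⟶ B ⊗ M) (p : M ⟶ M'') (q : L ⟶ L'')
        (y : L'' ⟶ B ⊗ M') (r : M ⟶ M') (f : B ⟶ A.X) (g : M'' ⟶ A.X) (k : M' ⟶ A.X)
        (h : q ≫ y = x ≫ B ◁ r) (h1 : p ≫ g = r ≫ k) :
        (x ≫ B ◁ p) ≫ (f ⊗ₘ g) ≫ μ[A.X] = q ≫ y ≫ (f ⊗ₘ k) ≫ μ[A.X] := by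
      rw [reassoc_of% h, Category.assoc, whiskerLeft_comp_tensorHom_assoc, h1,
        whiskerLeft_comp_tensorHom_assoc]
    exact key _ _ _ _ _ _ _ _ h h1

end OrderedMul

/-! ### Naturality and reindexing of permutations -/

section Naturality

variable {C : Type w} [Category.{v} C] [MonoidalCategory C] [SymmetricCategory C] {α β : Type*}
  {X Y : α → C}

/-- Naturality compares the same permutation on two families `X` and `Y`. It therefore needs
explicit positions, which `IsPermute` does not record. -/
lemma tensorMap_tensorExtract (φ : ∀ a, X a ⟶ Y a) : ∀ (l : List α) (i : Fin l.length),
    tensorMap φ l ≫ tensorExtract Y l i =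
      tensorExtract X l i ≫ (φ (l.get i) ⊗ₘ tensorMap φ (l.eraseIdx i))
  | [], i => i.elim0
  | _ :: _, ⟨0, _⟩ => (Category.comp_id _).trans (Category.id_comp _).symm
  | _ :: l, ⟨i + 1, h⟩ => by
    have key {A A' B B' L L' M M' : C} (f : A ⟶ A') (g : B ⟶ B') (k : L ⟶ L') (k' : M ⟶ M')
        (x : L ⟶ A ⊗ M) (y : L' ⟶ A' ⊗ M') (h : k ≫ y = x ≫ (f ⊗ₘ k')) :
        (g ⊗ₘ k) ≫ B' ◁ y ≫ swapFront B' A' M' =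
          (B ◁ x ≫ swapFront B A M) ≫ (f ⊗ₘ g ⊗ₘ k') := by
      rw [Category.assoc, ← swapFront_natural, tensorHom_comp_whiskerLeft_assoc, h,
        whiskerLeft_comp_tensorHom_assoc]
    exact key _ _ _ _ _ _ (tensorMap_tensorExtract φ l ⟨i, Nat.lt_of_succ_lt_succ h⟩)

/-- Permutations of the factors are natural. -/
lemma Reordering.tensorMap_permute (φ : ∀ a, X a ⟶ Y a) {l l' : List α} (σ : Reordering l l') :
    tensorMap φ l ≫ σ.permute Y = σ.permute X ≫ tensorMap φ l' := by
  induction σ with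
  | nil => rfl
  | @cons l l' i σ ih =>
    have key {A A' L L' M M' K K' : C} (f : A ⟶ A') (k : L ⟶ L') (k' : M ⟶ M') (j : K ⟶ K')
        (x : L ⟶ A ⊗ M) (y : L' ⟶ A' ⊗ M') (p : M ⟶ K) (q : M' ⟶ K')
        (h : k ≫ y = x ≫ (f ⊗ₘ k')) (h' : k' ≫ q = p ≫ j) :
        k ≫ y ≫ A' ◁ q = (x ≫ A ◁ p) ≫ (f ⊗ₘ j) := by
      rw [reassoc_of% h, tensorHom_comp_whiskerLeft, h', Category.assoc,
        whiskerLeft_comp_tensorHom]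
    exact key _ _ _ _ _ _ _ _ (tensorMap_tensorExtract φ l i) ih

lemma IsExtract.exists_tensorReindex (u : β → α) {b : β} {l m : List β}
    {x : tensor (fun b => X (u b)) l ⟶ X (u b) ⊗ tensor (fun b => X (u b)) m}
    (hx : IsExtract (fun b => X (u b)) b l m x) :
    ∃ y : tensor X (l.map u) ⟶ X (u b) ⊗ tensor X (m.map u),
      IsExtract X (u b) (l.map u) (m.map u) y ∧
      x ≫ X (u b) ◁ tensorReindex X u m = tensorReindex X u l ≫ y := by
  induction hx with
  | head l => exact ⟨_, .head _, (Category.id_comp _).trans (Category.comp_id _).symm⟩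
  | @tail l m c x hx ih =>
    obtain ⟨y, hy, h⟩ := ih
    refine ⟨_, .tail (u c) hy, ?_⟩
    have key {B D L L' M M' : C} (x : L ⟶ B ⊗ M) (y : L' ⟶ B ⊗ M') (r : L ⟶ L')
        (r' : M ⟶ M') (h : x ≫ B ◁ r' = r ≫ y) :
        (D ◁ x ≫ swapFront D B M) ≫ B ◁ D ◁ r' = D ◁ r ≫ D ◁ y ≫ swapFront D B M' := by
      rw [Category.assoc, ← swapFront_whisker, ← MonoidalCategory.whiskerLeft_comp_assoc, h,
        MonoidalCategory.whiskerLeft_comp_assoc]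
    exact key _ _ _ _ h

/-- A permutation of the index list `l` permutes the factors of the tensor product over
`l.map u`. -/
lemma IsPermute.exists_tensorReindex (u : β → α) {l l' : List β}
    {p : tensor (fun b => X (u b)) l ⟶ tensor (fun b => X (u b)) l'}
    (hp : IsPermute (fun b => X (u b)) l l' p) :
    ∃ q : tensor X (l.map u) ⟶ tensor X (l'.map u), IsPermute X (l.map u) (l'.map u) q ∧
      p ≫ tensorReindex X u l' = tensorReindex X u l ≫ q := by
  induction hp with
  | nil => exact ⟨_, .nil, rfl⟩
  | @cons b l m l' x p hx hp ih =>
    obtain ⟨y, hy, h⟩ := hx.exists_tensorReindex u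
    obtain ⟨q, hq, h'⟩ := ih
    refine ⟨_, .cons hy hq, ?_⟩
    have key {B L L' M M' K K' : C} (x : L ⟶ B ⊗ M) (y : L' ⟶ B ⊗ M') (r : L ⟶ L')
        (r' : M ⟶ M') (p : M ⟶ K) (s : K ⟶ K') (q : M' ⟶ K') (h : x ≫ B ◁ r' = r ≫ y)
        (h' : p ≫ s = r' ≫ q) : (x ≫ B ◁ p) ≫ B ◁ s = r ≫ y ≫ B ◁ q := by
      rw [Category.assoc, ← MonoidalCategory.whiskerLeft_comp, h',
        MonoidalCategory.whiskerLeft_comp, reassoc_of% h]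
    exact key _ _ _ _ _ _ _ h h'

end Naturality

/-! ### Permutations of blocks and rebracketing -/

section Flatten

variable {C : Type w} [Category.{v} C] [MonoidalCategory C] [SymmetricCategory C] {α β : Type*}
  {X : α → C}

lemma swapFront_whiskerRight_associator (A B M N : C) :
    swapFront B A M ▷ N ≫ (α_ A (B ⊗ M) N).hom ≫ A ◁ (α_ B M N).hom =
      (α_ B (A ⊗ M) N).hom ≫ B ◁ (α_ A M N).hom ≫ swapFront B A (M ⊗ N) := by
  unfold swapFront
  monoidal

lemma IsExtract.exists_append_right {a : α} {l m : List α} {x : tensor X l ⟶ X a ⊗ tensor X m}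
    (hx : IsExtract X a l m x) (n : List α) :
    ∃ y : tensor X (l ++ n) ⟶ X a ⊗ tensor X (m ++ n), IsExtract X a (l ++ n) (m ++ n) y ∧
      x ▷ tensor X n ≫ (α_ _ _ _).hom ≫ X a ◁ tensorAppend X m n = tensorAppend X l n ≫ y := by
  induction hx with
  | head l =>
    refine ⟨_, .head _, ?_⟩
    have key {A L N K : C} (t : L ⊗ N ⟶ K) :
        𝟙 (A ⊗ L) ▷ N ≫ (α_ _ _ _).hom ≫ A ◁ t = ((α_ _ _ _).hom ≫ A ◁ t) ≫ 𝟙 (A ⊗ K) := by simp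
    exact key _
  | @tail l m b x hx ih =>
    obtain ⟨y, hy, h⟩ := ih
    refine ⟨_, .tail b hy, ?_⟩
    have key {A B L M N K K' : C} (x : L ⟶ A ⊗ M) (t : L ⊗ N ⟶ K) (t' : M ⊗ N ⟶ K')
        (y : K ⟶ A ⊗ K') (h : x ▷ N ≫ (α_ _ _ _).hom ≫ A ◁ t' = t ≫ y) :
        (B ◁ x ≫ swapFront B A M) ▷ N ≫ (α_ _ _ _).hom ≫ A ◁ ((α_ _ _ _).hom ≫ B ◁ t') =
          ((α_ _ _ _).hom ≫ B ◁ t) ≫ B ◁ y ≫ swapFront B A K' := by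
      have hs := swapFront_whiskerRight_associator A B M N
      rw [comp_whiskerRight, MonoidalCategory.whiskerLeft_comp, Category.assoc, reassoc_of% hs,
        ← swapFront_whisker, Category.assoc, ← MonoidalCategory.whiskerLeft_comp_assoc B t y, ← h]
      simp
    exact key _ _ _ _ h

/-- A factor of the second block must cross all of the first, which the hexagon identity splits into
crossings of single factors. -/
lemma IsExtract.exists_append_left (l : List α) {a : α} {n n' : List α}
    {x : tensor X n ⟶ X a ⊗ tensor X n'} (hx : IsExtract X a n n' x) :
    ∃ y : tensor X (l ++ n) ⟶ X a ⊗ tensor X (l ++ n'), IsExtract X a (l ++ n) (l ++ n') y ∧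
      tensor X l ◁ x ≫ swapFront (tensor X l) (X a) (tensor X n') ≫ X a ◁ tensorAppend X l n' =
        tensorAppend X l n ≫ y := by
  induction l with
  | nil =>
    refine ⟨x, hx, ?_⟩
    have key {A N N' : C} (x : N ⟶ A ⊗ N') :
        𝟙_ C ◁ x ≫ swapFront (𝟙_ C) A N' ≫ A ◁ (λ_ N').hom = (λ_ N).hom ≫ x := by
      rw [swapFront_unit_left]; simp
    exact key x
  | cons b l ih =>
    obtain ⟨y, hy, h⟩ := ih
    refine ⟨_, .tail b hy, ?_⟩
    have key {A B L N N' K K' : C} (x : N ⟶ A ⊗ N') (t : L ⊗ N ⟶ K) (t' : L ⊗ N' ⟶ K')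
        (y : K ⟶ A ⊗ K') (h : L ◁ x ≫ swapFront L A N' ≫ A ◁ t' = t ≫ y) :
        (B ⊗ L) ◁ x ≫ swapFront (B ⊗ L) A N' ≫ A ◁ ((α_ _ _ _).hom ≫ B ◁ t') =
          ((α_ _ _ _).hom ≫ B ◁ t) ≫ B ◁ y ≫ swapFront B A K' := by
      rw [Category.assoc, ← MonoidalCategory.whiskerLeft_comp_assoc, ← h, swapFront_tensor_left]
      simp [swapFront_whisker]
    exact key _ _ _ _ h

/-- The exchange of two blocks of factors is a permutation. -/
lemma exists_isPermute_swapFront (X : α → C) (l l' n : List α) :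
    ∃ q : tensor X (l ++ (l' ++ n)) ⟶ tensor X (l' ++ (l ++ n)),
      IsPermute X (l ++ (l' ++ n)) (l' ++ (l ++ n)) q ∧
      tensor X l ◁ tensorAppend X l' n ≫ tensorAppend X l (l' ++ n) ≫ q =
        swapFront (tensor X l) (tensor X l') (tensor X n) ≫
          tensor X l' ◁ tensorAppend X l n ≫ tensorAppend X l' (l ++ n) := by
  induction l' with
  | nil =>
    refine ⟨_, .refl X _, ?_⟩
    have key {L N K : C} (t : L ⊗ N ⟶ K) :
        L ◁ (λ_ N).hom ≫ t ≫ 𝟙 K = swapFront L (𝟙_ C) N ≫ 𝟙_ C ◁ t ≫ (λ_ K).hom := by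
      rw [swapFront_unit_right]; simp
    exact key _
  | cons a l' ih =>
    obtain ⟨q, hq, h⟩ := ih
    -- The head of the second block crosses `l` first; the rest of that block follows by induction.
    obtain ⟨y, hy, h'⟩ := IsExtract.exists_append_left l (.head (X := X) (a := a) (l' ++ n))
    refine ⟨_, .cons hy hq, ?_⟩
    have key {A L L' N K K' K₁ K₂ K₃ : C} (t : L' ⊗ N ⟶ K) (t' : L ⊗ N ⟶ K') (t₁ : L ⊗ K ⟶ K₁)
        (t₂ : L ⊗ A ⊗ K ⟶ K₂) (t₃ : L' ⊗ K' ⟶ K₃) (q : K₁ ⟶ K₃) (y : K₂ ⟶ A ⊗ K₁)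
        (h : L ◁ t ≫ t₁ ≫ q = swapFront L L' N ≫ L' ◁ t' ≫ t₃)
        (h' : L ◁ 𝟙 (A ⊗ K) ≫ swapFront L A K ≫ A ◁ t₁ = t₂ ≫ y) :
        L ◁ ((α_ _ _ _).hom ≫ A ◁ t) ≫ t₂ ≫ y ≫ A ◁ q =
          swapFront L (A ⊗ L') N ≫ (A ⊗ L') ◁ t' ≫ (α_ _ _ _).hom ≫ A ◁ t₃ := by
      rw [← reassoc_of% h', swapFront_tensor_right]
      have h2 := congrArg (A ◁ ·) h
      simp only [MonoidalCategory.whiskerLeft_comp] at h2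
      simp only [MonoidalCategory.whiskerLeft_comp, MonoidalCategory.whiskerLeft_id,
        Category.id_comp, Category.assoc, swapFront_whisker_assoc, h2]
      simp
    exact key _ _ _ _ _ _ _ h h'

lemma IsPermute.exists_append {l l' m m' : List α} {p : tensor X l ⟶ tensor X l'}
    {q : tensor X m ⟶ tensor X m'} (hp : IsPermute X l l' p) (hq : IsPermute X m m' q) :
    ∃ r : tensor X (l ++ m) ⟶ tensor X (l' ++ m'), IsPermute X (l ++ m) (l' ++ m') r ∧
      (p ⊗ₘ q) ≫ tensorAppend X l' m' = tensorAppend X l m ≫ r := by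
  induction hp with
  | nil =>
    refine ⟨q, hq, ?_⟩
    have key {M M' : C} (q : M ⟶ M') : (𝟙 (𝟙_ C) ⊗ₘ q) ≫ (λ_ M').hom = (λ_ M).hom ≫ q := by simp
    exact key q
  | @cons a l n l' x p hx hp ih =>
    obtain ⟨r, hr, h⟩ := ih
    obtain ⟨y, hy, h'⟩ := hx.exists_append_right m
    refine ⟨_, .cons hy hr, ?_⟩
    have key {A L L' M M' N K K₁ K₂ : C} (x : L ⟶ A ⊗ N) (p : N ⟶ L') (q : M ⟶ M')
        (t : L' ⊗ M' ⟶ K) (t₁ : L ⊗ M ⟶ K₁) (t₂ : N ⊗ M ⟶ K₂) (y : K₁ ⟶ A ⊗ K₂) (r : K₂ ⟶ K)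
        (h : (p ⊗ₘ q) ≫ t = t₂ ≫ r) (h' : x ▷ M ≫ (α_ _ _ _).hom ≫ A ◁ t₂ = t₁ ≫ y) :
        ((x ≫ A ◁ p) ⊗ₘ q) ≫ (α_ _ _ _).hom ≫ A ◁ t = t₁ ≫ y ≫ A ◁ r := by
      rw [← reassoc_of% h', ← MonoidalCategory.whiskerLeft_comp, ← h, tensorHom_def p q]
      simp [MonoidalCategory.tensorHom_def]
    exact key _ _ _ _ _ _ _ _ h h'

/-- Permutations inside the blocks give a permutation of all factors. -/
lemma exists_isPermute_tensorFlatten {u u' : β → List α}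
    {p : ∀ b, tensor X (u b) ⟶ tensor X (u' b)} (hp : ∀ b, IsPermute X (u b) (u' b) (p b))
    (l : List β) :
    ∃ q : tensor X (l.flatMap u) ⟶ tensor X (l.flatMap u'),
      IsPermute X (l.flatMap u) (l.flatMap u') q ∧
      tensorMap p l ≫ tensorFlatten X u' l = tensorFlatten X u l ≫ q := by
  induction l with
  | nil => exact ⟨_, .nil, rfl⟩
  | cons b l ih =>
    obtain ⟨q, hq, h⟩ := ih
    obtain ⟨r, hr, h'⟩ := (hp b).exists_append hq
    refine ⟨r, hr, ?_⟩
    have key {B B' L L' K K' T T' : C} (p : B ⟶ B') (f : L ⟶ L') (g : L' ⟶ K') (g' : L ⟶ K)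
        (q : K ⟶ K') (t : B ⊗ K ⟶ T) (t' : B' ⊗ K' ⟶ T') (r : T ⟶ T') (h : f ≫ g = g' ≫ q)
        (h' : (p ⊗ₘ q) ≫ t' = t ≫ r) :
        (p ⊗ₘ f) ≫ B' ◁ g ≫ t' = (B ◁ g' ≫ t) ≫ r := by
      rw [tensorHom_comp_whiskerLeft_assoc, h, Category.assoc, ← h',
        whiskerLeft_comp_tensorHom_assoc]
    exact key _ _ _ _ _ _ _ _ h h'

/-- Extracting one block moves many factors, so after flattening it is in general no longer an
extraction but still a permutation. -/
lemma IsExtract.exists_tensorFlatten (u : β → List α) {b : β} {l m : List β}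
    {x : tensor (fun b => tensor X (u b)) l ⟶
      tensor X (u b) ⊗ tensor (fun b => tensor X (u b)) m}
    (hx : IsExtract (fun b => tensor X (u b)) b l m x) :
    ∃ q : tensor X (l.flatMap u) ⟶ tensor X (u b ++ m.flatMap u),
      IsPermute X (l.flatMap u) (u b ++ m.flatMap u) q ∧
      x ≫ tensor X (u b) ◁ tensorFlatten X u m ≫ tensorAppend X (u b) (m.flatMap u) =
        tensorFlatten X u l ≫ q := by
  induction hx with
  | head l => exact ⟨_, .refl X _, (Category.id_comp _).trans (Category.comp_id _).symm⟩
  | @tail l m c x hx ih =>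
    obtain ⟨q, hq, h⟩ := ih
    -- Bring block `b` forward behind the fixed block `c`, then exchange the two blocks.
    obtain ⟨r, hr, h'⟩ := (IsPermute.refl X (u c)).exists_append hq
    obtain ⟨s, hs, h''⟩ := exists_isPermute_swapFront X (u c) (u b) (m.flatMap u)
    refine ⟨_, hr.comp hs, ?_⟩
    have key {B D L M L' M' K₁ K₂ K₃ K₄ K₅ : C} (x : L ⟶ B ⊗ M) (f : M ⟶ M') (f' : L ⟶ L')
        (t₁ : D ⊗ M' ⟶ K₁) (t₂ : B ⊗ K₁ ⟶ K₂) (t₃ : D ⊗ L' ⟶ K₃) (t₄ : B ⊗ M' ⟶ K₄)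
        (t₅ : D ⊗ K₄ ⟶ K₅) (q : L' ⟶ K₄) (r : K₃ ⟶ K₅) (s : K₅ ⟶ K₂)
        (h : x ≫ B ◁ f ≫ t₄ = f' ≫ q) (h' : (𝟙 D ⊗ₘ q) ≫ t₅ = t₃ ≫ r)
        (h'' : D ◁ t₄ ≫ t₅ ≫ s = swapFront D B M' ≫ B ◁ t₁ ≫ t₂) :
        (D ◁ x ≫ swapFront D B M) ≫ B ◁ (D ◁ f ≫ t₁) ≫ t₂ = (D ◁ f' ≫ t₃) ≫ r ≫ s := by
      have h3 := congrArg (D ◁ ·) h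
      simp only [MonoidalCategory.whiskerLeft_comp] at h3
      simp only [MonoidalCategory.whiskerLeft_comp, Category.assoc]
      rw [← swapFront_whisker_assoc, ← h'', reassoc_of% h3, ← reassoc_of% h', id_tensorHom]
    exact key _ _ _ _ _ _ _ _ _ _ _ h h' h''

/-- A permutation of blocks gives a permutation of all factors. -/
lemma IsPermute.exists_tensorFlatten (u : β → List α) {l l' : List β}
    {p : tensor (fun b => tensor X (u b)) l ⟶ tensor (fun b => tensor X (u b)) l'}
    (hp : IsPermute (fun b => tensor X (u b)) l l' p) :
    ∃ q : tensor X (l.flatMap u) ⟶ tensor X (l'.flatMap u),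
      IsPermute X (l.flatMap u) (l'.flatMap u) q ∧
      p ≫ tensorFlatten X u l' = tensorFlatten X u l ≫ q := by
  induction hp with
  | nil => exact ⟨_, .nil, rfl⟩
  | @cons b l m l' x p hx hp ih =>
    obtain ⟨q, hq, h⟩ := ih
    obtain ⟨r, hr, h'⟩ := hx.exists_tensorFlatten u
    obtain ⟨s, hs, h''⟩ := (IsPermute.refl X (u b)).exists_append hq
    refine ⟨_, hr.comp hs, ?_⟩
    have key {B L M M' K K' T₁ T₂ T₃ : C} (x : L ⟶ B ⊗ M) (p : M ⟶ M') (f' : M' ⟶ K')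
        (f : M ⟶ K) (q : K ⟶ K') (g : L ⟶ T₁) (t₂ : B ⊗ K ⟶ T₂) (t₃ : B ⊗ K' ⟶ T₃) (r : T₁ ⟶ T₂)
        (s : T₂ ⟶ T₃) (h : p ≫ f' = f ≫ q) (h' : x ≫ B ◁ f ≫ t₂ = g ≫ r)
        (h'' : (𝟙 B ⊗ₘ q) ≫ t₃ = t₂ ≫ s) :
        (x ≫ B ◁ p) ≫ B ◁ f' ≫ t₃ = g ≫ r ≫ s := by
      rw [← reassoc_of% h', ← h'', id_tensorHom, Category.assoc,
        ← MonoidalCategory.whiskerLeft_comp_assoc, h, MonoidalCategory.whiskerLeft_comp_assoc]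
    exact key _ _ _ _ _ _ _ _ _ _ h h' h''

end Flatten

/-! ### Causal disjointness and time-ordering of composites -/

open LorentzManifold

/-- A point of `S'` in the causal past of `S` puts a point of `S` in the causal future of `S'`. -/
lemma causallyDisjoint_of_inter_eq_empty {M : LorentzManifold.{u}} {S S' : Set M}
    (h : causalFuture S ∩ S' = ∅) (h' : causalFuture S' ∩ S = ∅) : CausallyDisjoint S S' := by
  refine Set.eq_empty_iff_forall_notMem.2 ?_
  rintro y ⟨hy | ⟨x, hx, hyx⟩, hy'⟩
  · exact Set.eq_empty_iff_forall_notMem.1 h y ⟨hy, hy'⟩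
  · exact Set.eq_empty_iff_forall_notMem.1 h' x ⟨⟨y, hy', hyx⟩, hx⟩

/-- Time-orderings of the inner tuples and of the outer tuple give a time-ordering of the
composite tuple. -/
lemma isTimeOrdered_flatMap {N : Loc.{u}} {k : List (Σ f : Into N, Tuple f.1)}
    (hk : IsTimeOrdered (k.map Sigma.fst))
    {o : ∀ p : (Σ f : Into N, Tuple f.1), List (Into p.1.1)} (ho : ∀ p, IsTimeOrdered (o p)) :
    IsTimeOrdered (k.flatMap fun p => (o p).map (Tuple.after p.1)) := by
  refine List.pairwise_flatMap.2 ⟨fun p _ => List.pairwise_map.2 ((ho p).imp ?_),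
    (List.pairwise_map.1 hk).imp ?_⟩
  -- Inside one block, a causal relation in `N` between image points already holds in the source, by
  -- causal convexity of the image.
  · intro g g' hg
    refine Set.eq_empty_iff_forall_notMem.2 ?_
    rintro _ ⟨⟨_, ⟨x, rfl⟩, hx⟩, ⟨y, rfl⟩⟩
    exact Set.eq_empty_iff_forall_notMem.1 hg (g'.2.toFun y)
      ⟨⟨_, ⟨x, rfl⟩, p.1.2.causallyPrecedes_of_map hx⟩, ⟨y, rfl⟩⟩
  -- For different blocks, the composite images lie inside the outer images, which are already
  -- time-ordered.
  · intro p q hpq a ha b hb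
    obtain ⟨g, -, rfl⟩ := List.mem_map.1 ha
    obtain ⟨g', -, rfl⟩ := List.mem_map.1 hb
    refine Set.subset_empty_iff.1
      (hpq ▸ Set.inter_subset_inter ?_ (Tuple.image_after_subset _ _))
    rintro z ⟨x, hx, hxz⟩
    exact ⟨x, Tuple.image_after_subset _ _ hx, hxz⟩

/-! ### The axioms for the time-ordered products -/

namespace AQFT

variable {C : Type w} [Category.{v} C] [MonoidalCategory C] [SymmetricCategory C]

/-- Frees the product from the time-ordering chosen in `toPreTPFA`. Einstein causality is used here:
entries unordered in both directions are causally disjoint. -/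
lemma prod_eq_comp_orderedMul (A : AQFT.{u} C) {N : Loc.{u}} (f : Tuple N) {f' : List (Into N)}
    {p : tensor (fun g : Into N => (A.obj.obj g.1).X) f.1 ⟶
      tensor (fun g : Into N => (A.obj.obj g.1).X) f'}
    (hp : IsPermute (fun g : Into N => (A.obj.obj g.1).X) f.1 f' p) (hf' : IsTimeOrdered f') :
    A.toPreTPFA.prod f = p ≫ orderedMul (A.obj.obj N) (fun g => (A.obj.map g.2).hom) f' :=
  IsPermute.orderedMul_eq (A.obj.obj N) _
    (fun a b hab hba => A.property a.2 b.2 (causallyDisjoint_of_inter_eq_empty hab hba))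
    (Reordering.isPermute _ _) hp f.2.2.choose_spec.choose_spec hf'

lemma prod_comp (A : AQFT.{u} C) {N : Loc.{u}} (h : Tuple.Nested N) :
    A.toPreTPFA.nestedProd h = A.toPreTPFA.nestedFlatten h ≫ A.toPreTPFA.prod h.comp := by
  obtain ⟨f', hp, hf'⟩ := isTimeOrderable_iff.1 h.2
  -- Lift the time-ordering of the outer tuple to the pairs, so that each inner tuple moves along
  -- with its outer morphism.
  obtain ⟨k, hk, rfl⟩ := Tuple.exists_perm_map_eq _ hp
  choose o ho ho' using fun p : (Σ f : Into N, Tuple f.1) => isTimeOrderable_iff.1 p.2.2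
  obtain ⟨σ⟩ := Reordering.exists_of_perm hk
  have τ (p) := (Reordering.exists_of_perm (ho p)).some
  let X : Into N → C := fun g => (A.obj.obj g.1).X
  let φ : ∀ g : Into N, X g ⟶ (A.obj.obj N).X := fun g => (A.obj.map g.2).hom
  let T : (Σ f : Into N, Tuple f.1) → C := fun p =>
    tensor (fun g : Into p.1.1 => (A.obj.obj g.1).X) p.2.1
  let W : (Σ f : Into N, Tuple f.1) → C := fun p => tensor X (p.2.1.map (Tuple.after p.1))
  let ξ : ∀ p : (Σ f : Into N, Tuple f.1), T p ⟶ X p.1 := fun p => A.toPreTPFA.prod p.2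
  let ζ : ∀ p, T p ⟶ W p := fun p => tensorReindex X (Tuple.after p.1) p.2.1
  choose r hr hr' using fun p =>
    ((τ p).isPermute (fun g => X (Tuple.after p.1 g))).exists_tensorReindex (X := X)
      (Tuple.after p.1)
  -- An inner product pushed into `A(N)` becomes an ordered product there, because `A(f_i)` is
  -- multiplicative and `A` is functorial.
  have hinner (p) : ξ p ≫ φ p.1 = ζ p ≫ r p ≫ orderedMul (A.obj.obj N) φ _ := by
    refine (congrArg (· ≫ φ p.1)
      (A.prod_eq_comp_orderedMul p.2 ((τ p).isPermute _) (ho' p))).trans ?_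
    have h1 := orderedMul_comp_hom (fun g : Into p.1.1 => (A.obj.map g.2).hom) (A.obj.map p.1.2)
      (o p)
    have h2 : (fun g : Into p.1.1 => (A.obj.map g.2).hom ≫ (A.obj.map p.1.2).hom) =
        fun g => φ (Tuple.after p.1 g) :=
      funext fun g => congrArg Mon.Hom.hom (A.obj.map_comp g.2 p.1.2).symm
    replace h1 := h1.trans ((congrArg (fun ψ => orderedMul (A.obj.obj N) ψ (o p)) h2).trans
      (tensorReindex_orderedMul (A.obj.obj N) φ (Tuple.after p.1) (o p)).symm)
    refine (Category.assoc _ _ _).trans ((congrArg _ h1).trans ?_)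
    refine (Category.assoc _ _ _).symm.trans ((congrArg (· ≫ _) (hr' p)).trans ?_)
    exact Category.assoc _ _ _
  obtain ⟨q, hq, hq'⟩ := (σ.isPermute fun p => X p.1).exists_tensorReindex (X := X) Sigma.fst
  obtain ⟨s, hs, hs'⟩ := (σ.isPermute W).exists_tensorFlatten (X := X) _
  obtain ⟨t, ht, ht'⟩ := exists_isPermute_tensorFlatten hr k
  have houter := A.prod_eq_comp_orderedMul h.outer hq hf'
  -- The composite is time-ordered by permuting the blocks (`hs`) and then the factors inside each
  -- block (`ht`).
  have hcomp := A.prod_eq_comp_orderedMul h.comp (hs.comp ht) (isTimeOrdered_flatMap hf' ho')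
  have h1 := σ.tensorMap_permute ξ
  have h2 := σ.tensorMap_permute ζ
  have h3 := tensorReindex_orderedMul (A.obj.obj N) φ Sigma.fst k
  have h4 := tensorFlatten_orderedMul (A.obj.obj N) φ (fun p => (o p).map (Tuple.after p.1)) k
  have h5 := tensorMap_orderedMul (A.obj.obj N) ξ (fun p => φ p.1) k
  rw [funext hinner, ← tensorMap_orderedMul (A.obj.obj N) ζ, ← tensorMap_orderedMul (A.obj.obj N) r,
    ← h4] at h5
  -- Diagram chase: both sides equal the block permutation `pT`, followed by `z₂`, the inner
  -- permutations `R`, flattening and multiplication.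
  have key {T₁ T₂ Y₁ Y₂ W₁ W₂ X₁ X₂ F₁ F₂ F₃ F₄ D : C} {a₁ : T₁ ⟶ Y₁} {a₂ : T₂ ⟶ Y₂}
      {z₁ : T₁ ⟶ W₁} {z₂ : T₂ ⟶ W₂} {pT : T₁ ⟶ T₂} {pY : Y₁ ⟶ Y₂} {pW : W₁ ⟶ W₂}
      {i₁ : Y₁ ⟶ X₁} {i₂ : Y₂ ⟶ X₂} {q : X₁ ⟶ X₂} {f₁ : W₁ ⟶ F₁} {f₂ : W₂ ⟶ F₂} {s : F₁ ⟶ F₂}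
      {R : W₂ ⟶ F₃} {f₃ : F₃ ⟶ F₄} {t : F₂ ⟶ F₄} {m : X₂ ⟶ D} {n : Y₂ ⟶ D} {e : F₄ ⟶ D}
      (h1 : a₁ ≫ pY = pT ≫ a₂) (h2 : z₁ ≫ pW = pT ≫ z₂) (h3 : i₂ ≫ m = n)
      (h5 : a₂ ≫ n = z₂ ≫ R ≫ f₃ ≫ e) (hq : pY ≫ i₂ = i₁ ≫ q) (hs : pW ≫ f₂ = f₁ ≫ s)
      (ht : R ≫ f₃ = f₂ ≫ t) :
      a₁ ≫ i₁ ≫ q ≫ m = (z₁ ≫ f₁) ≫ (s ≫ t) ≫ e := by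
    rw [← reassoc_of% hq, h3, reassoc_of% h1, h5, reassoc_of% ht, ← reassoc_of% h2,
      reassoc_of% hs, Category.assoc, Category.assoc]
  have h6 := key h1 h2 h3 h5 hq' hs' ht'
  refine Eq.trans ?_ (h6.trans ?_)
  · exact congrArg (fun y => tensorMap ξ h.1 ≫ tensorReindex X Sigma.fst h.1 ≫ y) houter
  · exact congrArg (A.toPreTPFA.nestedFlatten h ≫ ·) hcomp.symm

lemma isTPFA (A : AQFT.{u} C) : A.toPreTPFA.IsTPFA where
  comp h := A.prod_comp h
  id M := by
    rw [A.prod_eq_comp_orderedMul (Tuple.single (𝟙 M)) (.refl _ _) (List.pairwise_singleton _ _)]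
    refine (Category.id_comp _).trans ((orderedMul_cons _ _ _ _).trans ?_)
    rw [A.obj.map_id, orderedMul_nil]
    have key (B : Mon C) : (Mon.Hom.hom (𝟙 B) ⊗ₘ η[B.X]) ≫ μ[B.X] = (ρ_ B.X).hom := by simp
    exact key _
  perm f f' σ := by
    -- Time-order the reordered tuple by `τ`; then `σ` followed by `τ` time-orders `f` into the same
    -- list.
    obtain ⟨f'', hp, h⟩ := isTimeOrderable_iff.1 (f.reorder σ).2
    obtain ⟨τ⟩ := Reordering.exists_of_perm hp
    have hσ := σ.isPermute fun g : Into _ => (A.obj.obj g.1).X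
    have hτ := τ.isPermute fun g : Into _ => (A.obj.obj g.1).X
    rw [A.prod_eq_comp_orderedMul f (hσ.comp hτ) h, A.prod_eq_comp_orderedMul _ hτ h]
    exact (Category.assoc _ _ _).symm

lemma isHom {A B : AQFT.{u} C} (κ : A ⟶ B) :
    A.toPreTPFA.IsHom B.toPreTPFA fun M => (κ.hom.app M).hom := by
  intro N f
  obtain ⟨f', hp, h⟩ := isTimeOrderable_iff.1 f.2
  obtain ⟨τ⟩ := Reordering.exists_of_perm hp
  -- Both theories use the same `τ`, so naturality of permutations applies.
  rw [A.prod_eq_comp_orderedMul f (τ.isPermute _) h, B.prod_eq_comp_orderedMul f (τ.isPermute _) h]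
  have h1 := orderedMul_comp_hom (fun g : Into N => (A.obj.map g.2).hom) (κ.hom.app N) f'
  have h2 := tensorMap_orderedMul (B.obj.obj N) (fun g : Into N => (κ.hom.app g.1).hom)
    (fun g => (B.obj.map g.2).hom) f'
  have h3 := τ.tensorMap_permute fun g : Into N => (κ.hom.app g.1).hom
  have h4 : (fun g : Into N => (κ.hom.app g.1).hom ≫ (B.obj.map g.2).hom) =
      fun g => (A.obj.map g.2).hom ≫ (κ.hom.app N).hom :=
    funext fun g => congrArg Mon.Hom.hom (κ.hom.naturality g.2).symm
  rw [h4, ← h1] at h2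
  refine (Category.assoc _ _ _).trans ((congrArg _ h2.symm).trans ?_)
  refine (Category.assoc _ _ _).symm.trans ((congrArg (· ≫ _) h3.symm).trans ?_)
  exact Category.assoc _ _ _

end AQFT

end LorentzQFT

open LorentzQFT
theorem theorem4p4 {C : Type w} [Category.{v} C] [MonoidalCategory C] [SymmetricCategory C] :
    -- the time-ordered product does not depend on the choice of time-ordering permutation
    (∀ (A : AQFT.{u} C) {N : Loc.{u}} (f : Tuple N) {f' : List (Into N)} (ρ : Reordering f.1 f'),
      IsTimeOrdered f' → A.toPreTPFA.prod f = A.orderedProd ρ) ∧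
    -- the empty tuple is sent to the unit
    (∀ (A : AQFT.{u} C) (N : Loc.{u}),
      A.toPreTPFA.prod (Tuple.empty N) = η[(A.obj.obj N).X]) ∧
    -- these data are a time-orderable prefactorization algebra, functorially in `A`
    ∃ (hobj : ∀ A : AQFT.{u} C, A.toPreTPFA.IsTPFA)
      (hmap : ∀ {A B : AQFT.{u} C} (κ : A ⟶ B),
        A.toPreTPFA.IsHom B.toPreTPFA fun M => (κ.hom.app M).hom)
      (F : AQFT.{u} C ⥤ TPFA.{u} C),
      F.toPrefunctor =
        { obj := fun A => ⟨A.toPreTPFA, hobj A⟩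
          map := fun κ => ⟨fun M => (κ.hom.app M).hom, hmap κ⟩ } := by
  refine ⟨fun A N f f' ρ hf' => A.prod_eq_comp_orderedMul f (ρ.isPermute _) hf', fun A N => ?_,
    fun A => A.isTPFA, fun κ => AQFT.isHom κ,
    { obj := fun A => ⟨A.toPreTPFA, A.isTPFA⟩
      map := fun κ => ⟨fun M => (κ.hom.app M).hom, AQFT.isHom κ⟩
      map_id := fun A => rfl
      map_comp := fun κ κ' => rfl }, rfl⟩
  -- The empty list is its own time-ordering, and its ordered product is the unit.
  rw [A.prod_eq_comp_orderedMul (Tuple.empty N) .nil .nil]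
  exact (Category.id_comp _).trans (orderedMul_nil _ _)
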